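/- **Setting.** Let $p\ge 1$ be an integer, let $\theta_0\in\mathbb R^p$ with $\|\theta_0\|=1$, let $\xi>0$, let $(\delta_n)_{n\ge1}$ and $(\nu_n)_{n\ge1}$ be sequences of positive reals, and let $(\tau_n)_{n\ge1}$ be a bounded sequence in $\mathbb R^p$ such that $\|\theta_0+\nu_n\tau_n\|=1$ for every $n\ge1$. Put $$V_{0n}=\Big(1-\frac{\delta_n\xi}{p}\Big)I_p+\delta_n\xi\,\theta_0\theta_0',\qquad V_{1n}=\Big(1-\frac{\delta_n\xi}{p}\Big)I_p+\delta_n\xi\,(\theta_0+\nu_n\tau_n)(\theta_0+\nu_n\tau_n)',$$ and assume that $V_{0n}$ is positive definite for every $n\ge1$. For a symmetric positive definite $p\times p$ matrix $V$, let $\mathrm P^{(n)}_V$ be the law of an i.i.d. sample $U_{n1},\dots,U_{nn}$ from the angular Gaussian distribution with shape matrix $V$, that is, from the distribution on the unit sphere of $\mathbb R^p$ with density $$u\mapsto \frac{\Gamma(p/2)}{2\pi^{p/2}(\det V)^{1/2}}\,(u'V^{-1}u)^{-p/2}$$ with respect to the surface area measure. Let $$\Lambda_n=\log\frac{d\mathrm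 P^{(n)}_{V_{1n}}}{d\mathrm P^{(n)}_{V_{0n}}},\qquad \gamma_n=\frac{p\,\delta_n\xi}{p+(p-1)\delta_n\xi},\qquad S_n(V)=\frac1n\sum_{i=1}^n\frac{V^{-1/2}U_{ni}U_{ni}'V^{-1/2}}{\|V^{-1/2}U_{ni}\|^2}.$$ With $e_1,\dots,e_p$ the canonical basis of $\mathbb R^p$, let $K_p=\sum_{i,j=1}^p(e_ie_j')\otimes(e_je_i')$ and $J_p=\sum_{i,j=1}^p(e_ie_j')\otimes(e_ie_j')$, and let $\mathrm{vec}$ denote column stacking. **Theorem.** As $n\to\infty$, under $\mathrm P^{(n)}_{V_{0n}}$: (i) Suppose $\delta_n=1$ for all $n$. Let $$\Gamma^{(i)}=\frac{p(p+(p-1)\xi)}{(p+2)(p-\xi)}(I_p-\theta_0\theta_0'),\qquad \Delta^{(i)}_n=p\,\frac{\sqrt{p+(p-1)\xi}}{\sqrt{p-\xi}}\,(I_p-\theta_0\theta_0')\sqrt n\Big(S_n(V_{0n})-\tfrac1pI_p\Big)\theta_0$$ (if $p=1$, both are zero). If $\nu_n=1/(\sqrt n\gamma_n)$ for all $n$,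 then $$\Lambda_n=\tau_n'\Delta^{(i)}_n-\tfrac12\tau_n'\Gamma^{(i)}\tau_n+o_{\mathrm P}(1).$$ Moreover, $\Delta^{(i)}_n$ is asymptotically normal with mean zero and covariance matrix $\Gamma^{(i)}$. (ii) Suppose $\delta_n\to0$ and $\sqrt n\,\delta_n\to\infty$. Let $$\Gamma^{(ii)}=\frac{p}{p+2}(I_p-\theta_0\theta_0'),\qquad \Delta^{(ii)}_n=p\,(I_p-\theta_0\theta_0')\sqrt n\Big(S_n(V_{0n})-\tfrac1pI_p\Big)\theta_0.$$ If $\nu_n=1/(\sqrt n\gamma_n)$ for all $n$, then $$\Lambda_n=\tau_n'\Delta^{(ii)}_n-\tfrac12\tau_n'\Gamma^{(ii)}\tau_n+o_{\mathrm P}(1).$$ Moreover, $\Delta^{(ii)}_n$ is asymptotically normal with mean zero and covariance matrix $\Gamma^{(ii)}$. (iii) Suppose $\delta_n=1/\sqrt n$ for all $n$. Let $\Upsilon_n=p\sqrt n\,\big(S_n(V_{0n})-\tfrac1pI_p\big)$. If $\nu_n=1/(\sqrt n\gamma_n)$ for all $n$, or if $\nu_n=1/\xi$ for all $n$, then $$\Lambda_n=\tau_n'\Upsilon_n\theta_0+\frac1{2\xi}\tau_n'\Upsilon_n\tau_n-\frac{p}{2(p+2)}\Big(\|\tau_n\|^2-\frac1{4\xi^2}\|\tau_n\|^4\Big)+o_{\mathrm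 P}(1).$$ Moreover, $\mathrm{vec}(\Upsilon_n)$ is asymptotically normal with mean zero and covariance matrix $\frac{p}{p+2}(I_{p^2}+K_p+J_p)-J_p$. (iv) If $\sqrt n\,\delta_n\to0$, then $\Lambda_n=o_{\mathrm P}(1)$, whatever the sequences $(\nu_n)$ and $(\tau_n)$ above; in particular this holds for $\nu_n\equiv1/\xi$. -/

import Mathlib

open MeasureTheory ProbabilityTheory Filter Topology Matrix
open scoped Kronecker BoundedContinuousFunction

noncomputable section

namespace SignPCA

/-! ### Vectors and matrices -/

/-- `ℝᵖ` with its Euclidean norm. -/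
abbrev Vec (p : ℕ) := EuclideanSpace ℝ (Fin p)

/-- The unit sphere `𝒮ᵖ⁻¹` of `ℝᵖ`. -/
abbrev Sph (p : ℕ) := Metric.sphere (0 : Vec p) 1

/-- Real `p × p` matrices. -/
abbrev Mat (p : ℕ) := Matrix (Fin p) (Fin p) ℝ

/-- The rank-one matrix `x y'`. -/
def outer {p : ℕ} (x y : Vec p) : Mat p := Matrix.vecMulVec x.ofLp y.ofLp

/-- The vector `A x`. -/
def act {p : ℕ} (A : Mat p) (x : Vec p) : Vec p := WithLp.toLp 2 (A *ᵥ x.ofLp)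

/-- The number `x' A y`. -/
def bilin {p : ℕ} (x : Vec p) (A : Mat p) (y : Vec p) : ℝ := x.ofLp ⬝ᵥ (A *ᵥ y.ofLp)

section
open scoped MatrixOrder

/-- `V^{-1/2}`, the inverse of the positive semidefinite square root of `V`. -/
def invSqrt {p : ℕ} (V : Mat p) : Mat p := (CFC.sqrt V)⁻¹

end

/-- The `p² × p²` commutation matrix `K_p = ∑ᵢⱼ (eᵢ eⱼ') ⊗ (eⱼ eᵢ')`. -/
def commutationMatrix (p : ℕ) : Matrix (Fin p × Fin p) (Fin p × Fin p) ℝ :=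
  ∑ i : Fin p, ∑ j : Fin p, Matrix.single i j (1 : ℝ) ⊗ₖ Matrix.single j i (1 : ℝ)

/-- `J_p = ∑ᵢⱼ (eᵢ eⱼ') ⊗ (eᵢ eⱼ') = (vec I_p)(vec I_p)'`. -/
def Jmat (p : ℕ) : Matrix (Fin p × Fin p) (Fin p × Fin p) ℝ :=
  ∑ i : Fin p, ∑ j : Fin p, Matrix.single i j (1 : ℝ) ⊗ₖ Matrix.single i j (1 : ℝ)

/-- `vec A`, the stacked columns of `A`, as a vector of `ℝ^{p²}`. -/
def vecE {p : ℕ} (A : Mat p) : EuclideanSpace ℝ (Fin p × Fin p) := WithLp.toLp 2 A.vec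

/-! ### Angular Gaussian model -/

/-- The angular Gaussian density
`u ↦ Γ(p/2) / (2 π^{p/2} (det V)^{1/2}) (u' V⁻¹ u)^{-p/2}`. -/
def angularGaussianDensity {p : ℕ} (V : Mat p) (u : Vec p) : ℝ :=
  Real.Gamma ((p : ℝ) / 2) / (2 * Real.pi ^ ((p : ℝ) / 2) * Real.sqrt V.det) *
    (bilin u V⁻¹ u) ^ (-((p : ℝ) / 2))

/-- The angular Gaussian distribution on the unit sphere with shape matrix `V`: it has density
`angularGaussianDensity V` with respect to the surface area measure. -/
def angularGaussian {p : ℕ} (V : Mat p) : Measure (Sph p) :=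
  ((volume : Measure (Vec p)).toSphere).withDensity
    fun u => ENNReal.ofReal (angularGaussianDensity V (u : Vec p))

/-- `P_V^{(n)}`: the law of a random sample of size `n` from the angular Gaussian distribution
with shape matrix `V`. -/
def sampleLaw {p : ℕ} (n : ℕ) (V : Mat p) : Measure (Fin n → Sph p) :=
  Measure.pi fun _ => angularGaussian V

/-- The single-spike matrix `(1 - δ ξ / p) I_p + δ ξ θ θ'`. -/
def spikeShape {p : ℕ} (ξ δ : ℝ) (θ : Vec p) : Mat p :=
  (1 - δ * ξ / p) • (1 : Mat p) + (δ * ξ) • outer θ θ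

/-- The log-likelihood ratio `log (dP_{V₁}^{(n)} / dP_{V₀}^{(n)})`. -/
def logLik {p : ℕ} (n : ℕ) (V₀ V₁ : Mat p) : (Fin n → Sph p) → ℝ :=
  llr (sampleLaw n V₁) (sampleLaw n V₀)

/-- `S_n(V) = n⁻¹ ∑ᵢ V^{-1/2} Uᵢ Uᵢ' V^{-1/2} / ‖V^{-1/2} Uᵢ‖²`. -/
def scatter {p n : ℕ} (V : Mat p) (U : Fin n → Sph p) : Mat p :=
  (1 / (n : ℝ)) • ∑ i, (1 / ‖act (invSqrt V) (U i : Vec p)‖ ^ 2) •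
    (invSqrt V * outer (U i : Vec p) (U i : Vec p) * invSqrt V)

/-- `γ_n = p δ_n ξ / (p + (p - 1) δ_n ξ)`. -/
def gam (p : ℕ) (ξ δ : ℝ) : ℝ := p * δ * ξ / (p + (p - 1) * δ * ξ)

/-! ### Central sequences and information matrices -/

/-- `√n (S_n(V) - I_p / p)`. -/
def centeredScatter {p n : ℕ} (V : Mat p) (U : Fin n → Sph p) : Mat p :=
  Real.sqrt n • (scatter V U - (1 / (p : ℝ)) • (1 : Mat p))

/-- Fisher information in regime (i). -/
def infoI {p : ℕ} (ξ : ℝ) (θ₀ : Vec p) : Mat p :=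
  (p * (p + (p - 1) * ξ) / ((p + 2) * (p - ξ)) : ℝ) • ((1 : Mat p) - outer θ₀ θ₀)

/-- Central sequence in regime (i), with `V = V_{0n}`. -/
def deltaI {p n : ℕ} (ξ : ℝ) (θ₀ : Vec p) (V : Mat p) (U : Fin n → Sph p) : Vec p :=
  (p * (Real.sqrt (p + (p - 1) * ξ) / Real.sqrt (p - ξ)) : ℝ) •
    act (((1 : Mat p) - outer θ₀ θ₀) * centeredScatter V U) θ₀

/-- Fisher information in regime (ii). -/
def infoII {p : ℕ} (θ₀ : Vec p) : Mat p :=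
  (p / (p + 2) : ℝ) • ((1 : Mat p) - outer θ₀ θ₀)

/-- Central sequence in regime (ii), with `V = V_{0n}`. -/
def deltaII {p n : ℕ} (θ₀ : Vec p) (V : Mat p) (U : Fin n → Sph p) : Vec p :=
  (p : ℝ) • act (((1 : Mat p) - outer θ₀ θ₀) * centeredScatter V U) θ₀

/-- The matrix statistic `Υ = p √n (S_n(V) - I_p / p)` of regime (iii), with `V = V_{0n}`. -/
def upsilon {p n : ℕ} (V : Mat p) (U : Fin n → Sph p) : Mat p :=
  (p : ℝ) • centeredScatter V U

/-- Asymptotic covariance matrix `(p/(p+2)) (I_{p²} + K_p + J_p) - J_p` of `vec Υ`. -/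
def covIII (p : ℕ) : Matrix (Fin p × Fin p) (Fin p × Fin p) ℝ :=
  (p / (p + 2) : ℝ) • (1 + commutationMatrix p + Jmat p) - Jmat p

/-! ### Stochastic convergence along a sequence of probability measures -/

/-- `X_n = o_P(1)` under the sequence `P_n`. -/
def IsLittleOP {Ω : ℕ → Type*} [∀ n, MeasurableSpace (Ω n)] (P : ∀ n, Measure (Ω n))
    (X : ∀ n, Ω n → ℝ) : Prop :=
  ∀ ε : ℝ, 0 < ε → Tendsto (fun n => P n {ω | ε ≤ |X n ω|}) atTop (𝓝 0)

/-- Under `P_n`, the random vector `X_n` is asymptotically normal with mean zero and covariance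
matrix `C`: the laws of `X_n` converge weakly to `N(0, C)`. -/
def AsympNormal {Ω : ℕ → Type*} [∀ n, MeasurableSpace (Ω n)] {ι : Type*} [Fintype ι]
    [DecidableEq ι] (P : ∀ n, Measure (Ω n)) (X : ∀ n, Ω n → EuclideanSpace ℝ ι)
    (C : Matrix ι ι ℝ) : Prop :=
  (∀ n, AEMeasurable (X n) (P n)) ∧
    ∀ f : EuclideanSpace ℝ ι →ᵇ ℝ,
      Tendsto (fun n => ∫ ω, f (X n ω) ∂(P n)) atTop (𝓝 (∫ x, f x ∂(multivariateGaussian 0 C)))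

end SignPCA

end

open MeasureTheory ProbabilityTheory Filter Topology Matrix
open scoped Kronecker BoundedContinuousFunction

noncomputable section

namespace SignPCA

/-! ### Linear algebra glue -/

/-! Whitening removes the null shape. If `R` is the symmetric square root of `V₀` and `U` is angular
Gaussian with shape `V₀`, then `W = R⁻¹U / ‖R⁻¹U‖` is uniform on the sphere
(`map_sphMap_angularGaussian`). The scatter statistic is the empirical second moment matrix of the
`W i`. The two shapes have equal determinants, so the log-likelihood ratio is almost everywhere `∑
-(p/2) log (1 + W' E W)` with `1 + E = R V₁⁻¹ R` (`logLik_ae_eq`). All four regimes thus become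
statements about i.i.d. uniform directions and a small deterministic matrix `E`.

The core is `isLittleOP_quadratic_expansion`: if `√n E + 2H → 0` with `H` bounded, the
log-likelihood ratio is `tr (H Υ) - p/(p+2) tr (H²) + o_P(1)`. The summands of the error are
uniformly `o(1/√n)` and their mean is `o(1/n)`, so Chebyshev's inequality suffices
(`isLittleOP_sum_of_small`). The mean is delicate because `tr E` enters at first order. As `E` has
rank at most two and `det (1 + E) = 1`, one has `2 tr E = tr (E²) - (tr E)²`, so `tr E = O(1/n)`.
With the fourth moments of the uniform law, this first-order term contributes `-tr (H²)` and the
quadratic term of the logarithm `2/(p+2) tr (H²)`, which add up to `-p/(p+2) tr (H²)`.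

For spikes, `V = a I + b θθ'`, and `E` is a multiple of `(Rθ₀)(Rθ₀)' - (Rθ₁)(Rθ₁)'`. With `θ₁ = θ₀ +
ν τ`, the matrix `√n E` is an explicit function of `a`, `b`, `c = √n ν b/(a+b)`, `ν` and `τ`. The
rate `γ` equals `b/(a+b)`, so `ν = 1/(√n γ)` means `c = 1`. The regimes are limits of that function.
If `ν → 0`, only the tangential part of `τ` survives, giving local asymptotic normality with factor
`κ = √((a+b)/a)` in the limit. If `ν → 1/ξ` and `b → 0`, the term in `ττ'` survives as well. If `√n
b → 0`, then `H = 0`. Since `τ` is only bounded, limits are taken uniformly on compact sets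
(`tendsto_zero_of_isCompact`).

Asymptotic normality of the central sequences is the central limit theorem for uniform directions
(`tendsto_integral_normalized_sum`), with covariances given by the fourth moments. -/

lemma act_act {p : ℕ} (A B : Mat p) (x : Vec p) : act A (act B x) = act (A * B) x := by
  simp [act, Matrix.mulVec_mulVec]

lemma act_one {p : ℕ} (x : Vec p) : act 1 x = x := by
  simp [act]

lemma act_smul {p : ℕ} (A : Mat p) (c : ℝ) (x : Vec p) : act A (c • x) = c • act A x := by
  simp [act, Matrix.mulVec_smul]

lemma act_eq_toEuclideanLin {p : ℕ} (A : Mat p) : act A = Matrix.toEuclideanLin A := rfl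

lemma continuous_act {p : ℕ} (A : Mat p) : Continuous (act A) := by
  rw [act_eq_toEuclideanLin]
  exact LinearMap.continuous_of_finiteDimensional _

lemma inner_eq_dotProduct {p : ℕ} (x y : Vec p) : inner ℝ x y = x.ofLp ⬝ᵥ y.ofLp := by
  rw [EuclideanSpace.inner_eq_star_dotProduct, star_trivial, dotProduct_comm]

lemma bilin_eq_inner {p : ℕ} (x : Vec p) (A : Mat p) (y : Vec p) :
    bilin x A y = inner ℝ x (act A y) := by
  rw [inner_eq_dotProduct]; rfl

lemma inner_act_left {p : ℕ} (A : Mat p) (x y : Vec p) :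
    inner ℝ (act A x) y = inner ℝ x (act Aᵀ y) := by
  rw [inner_eq_dotProduct, inner_eq_dotProduct]
  simp only [act]
  rw [Matrix.dotProduct_mulVec, Matrix.vecMul_transpose]

lemma volume_image_act {p : ℕ} (A : Mat p) (s : Set (Vec p)) :
    (volume : Measure (Vec p)) (act A '' s) = ENNReal.ofReal |A.det| * volume s := by
  have h := Measure.addHaar_image_linearMap (volume : Measure (Vec p)) (Matrix.toEuclideanLin A) s
  rw [act_eq_toEuclideanLin, h]
  congr 3
  exact LinearMap.det_toLpLin ..

lemma norm_sph {p : ℕ} (w : Sph p) : ‖(w : Vec p)‖ = 1 := by simp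

lemma sph_ne_zero {p : ℕ} (w : Sph p) : (w : Vec p) ≠ 0 := by
  rw [← norm_ne_zero_iff, norm_sph]; norm_num

/-! ### The uniform distribution on the sphere -/

/-- The uniform distribution on the unit sphere. -/
def sphUnif (p : ℕ) : Measure (Sph p) :=
  ENNReal.ofReal (Real.Gamma ((p : ℝ) / 2) / (2 * Real.pi ^ ((p : ℝ) / 2))) •
    (volume : Measure (Vec p)).toSphere

lemma isProbabilityMeasure_sphUnif {p : ℕ} (hp : p ≠ 0) : IsProbabilityMeasure (sphUnif p) := by
  have : Nonempty (Fin p) := ⟨⟨0, Nat.pos_of_ne_zero hp⟩⟩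
  have hp' : (0 : ℝ) < p := by exact_mod_cast Nat.pos_of_ne_zero hp
  have hG : 0 < Real.Gamma ((p : ℝ) / 2) := Real.Gamma_pos_of_pos (by positivity)
  constructor
  rw [sphUnif, Measure.smul_apply, Measure.toSphere_apply_univ, EuclideanSpace.volume_ball]
  simp only [finrank_euclideanSpace, Fintype.card_fin, ENNReal.ofReal_one, one_pow, one_mul,
    smul_eq_mul]
  rw [← ENNReal.ofReal_natCast, ← ENNReal.ofReal_mul (by positivity),
    ← ENNReal.ofReal_mul (by positivity), Real.Gamma_add_one (by positivity)]
  have : (√Real.pi) ^ p = Real.pi ^ ((p : ℝ) / 2) := by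
    rw [Real.sqrt_eq_rpow, ← Real.rpow_natCast, ← Real.rpow_mul Real.pi_pos.le]
    congr 1; ring
  rw [this, ← ENNReal.ofReal_one]
  congr 1
  have : (0 : ℝ) < Real.pi ^ ((p : ℝ) / 2) := by positivity
  field_simp

/-- The direction of `B u`. -/
def sphMap {p : ℕ} (B : Mat p) (u : Sph p) : Sph p :=
  if h : act B (u : Vec p) = 0 then u else
    ⟨‖act B (u : Vec p)‖⁻¹ • act B (u : Vec p), by
      rw [mem_sphere_zero_iff_norm, norm_smul, norm_inv, norm_norm,
        inv_mul_cancel₀ (norm_ne_zero_iff.2 h)]⟩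

lemma act_ne_zero {p : ℕ} {B : Mat p} (hB : B.det ≠ 0) {x : Vec p} (hx : x ≠ 0) :
    act B x ≠ 0 := by
  intro h
  apply hx
  have := congrArg (act B⁻¹) h
  rw [act_act, Matrix.nonsing_inv_mul _ (isUnit_iff_ne_zero.2 hB), act_one] at this
  rw [this, act_eq_toEuclideanLin, map_zero]

lemma coe_sphMap {p : ℕ} {B : Mat p} (hB : B.det ≠ 0) (u : Sph p) :
    (sphMap B u : Vec p) = ‖act B (u : Vec p)‖⁻¹ • act B (u : Vec p) := by
  rw [sphMap, dif_neg (act_ne_zero hB (sph_ne_zero u))]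

lemma measurable_sphMap {p : ℕ} {B : Mat p} (hB : B.det ≠ 0) : Measurable (sphMap B) := by
  have hc : Continuous fun u : Sph p => (sphMap B u : Vec p) := by
    have h1 : Continuous fun u : Sph p => act B (u : Vec p) :=
      (continuous_act B).comp continuous_subtype_val
    simp_rw [coe_sphMap hB]
    exact (h1.norm.inv₀ fun u => norm_ne_zero_iff.2 (act_ne_zero hB (sph_ne_zero u))).smul h1
  exact (Continuous.subtype_mk hc fun u => (sphMap B u).2).measurable

/-- Polar coordinates for the cone over a set of directions with direction-dependent height. -/
lemma lintegral_toSphere_cone {p : ℕ} (hp : p ≠ 0) {s : Set (Sph p)} (hs : MeasurableSet s)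
    {g : Sph p → ℝ} (hg : Measurable g) (hg0 : ∀ u, 0 < g u) :
    ∫⁻ u in s, ENNReal.ofReal (g u ^ p / p) ∂(volume : Measure (Vec p)).toSphere =
      volume {x : Vec p | ∃ u ∈ s, ∃ r : ℝ, 0 < r ∧ r < g u ∧ x = r • (u : Vec p)} := by
  have : Nonempty (Fin p) := ⟨⟨0, Nat.pos_of_ne_zero hp⟩⟩
  have : Nontrivial (Vec p) := inferInstance
  set T : Set (Sph p × Set.Ioi (0 : ℝ)) := {z | z.1 ∈ s ∧ (z.2 : ℝ) < g z.1} with hT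
  have hTm : MeasurableSet T :=
    (measurable_fst hs).inter (measurableSet_lt (by fun_prop) (hg.comp measurable_fst))
  have hmp := Measure.measurePreserving_homeomorphUnitSphereProd (volume : Measure (Vec p))
  have hfin : Module.finrank ℝ (Vec p) - 1 = p - 1 := by simp
  have hpp : ((p - 1 : ℕ) : ℝ) + 1 = p := by
    rw [Nat.cast_pred (Nat.pos_of_ne_zero hp)]; ring
  have h1 := hmp.measure_preimage hTm.nullMeasurableSet
  rw [comap_subtype_coe_apply (measurableSet_singleton _).compl, Measure.prod_apply hTm,
    hfin] at h1
  -- The radial measure has density `r^(p-1)`, whose integral over `(0, g u)` is `g u ^ p / p`.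
  have h2 : ∀ u, (Measure.volumeIoiPow (p - 1)) (Prod.mk u ⁻¹' T) =
      s.indicator (fun u => ENNReal.ofReal (g u ^ p / p)) u := by
    intro u
    by_cases hu : u ∈ s
    · have : Prod.mk u ⁻¹' T = Set.Iio (⟨g u, hg0 u⟩ : Set.Ioi (0 : ℝ)) := by
        ext r; simp [hT, hu, ← Subtype.coe_lt_coe]
      rw [this, Measure.volumeIoiPow_apply_Iio, Set.indicator_of_mem hu, hpp,
        Nat.sub_add_cancel (Nat.pos_of_ne_zero hp)]
    · have : Prod.mk u ⁻¹' T = ∅ := by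
        ext r; simp [hT, hu]
      rw [this, measure_empty, Set.indicator_of_notMem hu]
  simp_rw [h2] at h1
  rw [lintegral_indicator hs] at h1
  rw [← h1]
  congr 1
  ext x
  simp only [Set.mem_image, Set.mem_preimage, Set.mem_ofPred_eq, hT]
  constructor
  · rintro ⟨y, ⟨hy1, hy2⟩, rfl⟩
    refine ⟨_, hy1, _, (homeomorphUnitSphereProd (Vec p) y).2.2, hy2, ?_⟩
    have hy : (y : Vec p) ≠ 0 := y.2
    simp [smul_smul, hy]
  · rintro ⟨u, hu, r, hr0, hr, rfl⟩
    refine ⟨(homeomorphUnitSphereProd (Vec p)).symm (u, ⟨r, hr0⟩), ?_, by simp⟩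
    rw [Homeomorph.apply_symm_apply]
    exact ⟨hu, hr⟩

open scoped Pointwise in
/-- If `U` is angular Gaussian with shape `R R'`, then the direction of `R⁻¹ U` is uniform. -/
lemma map_sphMap_angularGaussian {p : ℕ} (hp : p ≠ 0) {R V : Mat p} (hR : R.det ≠ 0)
    (hV : V = R * Rᵀ) : (angularGaussian V).map (sphMap R⁻¹) = sphUnif p := by
  have hp' : (0 : ℝ) < p := by exact_mod_cast Nat.pos_of_ne_zero hp
  have hRi : R⁻¹.det ≠ 0 := by
    rw [Matrix.det_nonsing_inv, Ring.inverse_eq_inv']; exact inv_ne_zero hR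
  have hRR : R * R⁻¹ = 1 := Matrix.mul_nonsing_inv _ (isUnit_iff_ne_zero.2 hR)
  have hRR' : R⁻¹ * R = 1 := Matrix.nonsing_inv_mul _ (isUnit_iff_ne_zero.2 hR)
  have hq : ∀ u : Vec p, bilin u V⁻¹ u = ‖act R⁻¹ u‖ ^ 2 := by
    intro u
    rw [bilin_eq_inner, hV, Matrix.mul_inv_rev, ← act_act, ← Matrix.transpose_nonsing_inv,
      ← inner_act_left, real_inner_self_eq_norm_sq]
  have hdet : √V.det = |R.det| := by
    rw [hV, Matrix.det_mul, Matrix.det_transpose, Real.sqrt_mul_self_eq_abs]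
  have hm := measurable_sphMap hRi
  have hn : ∀ u : Sph p, 0 < ‖act R⁻¹ (u : Vec p)‖ := fun u =>
    norm_pos_iff.2 (act_ne_zero hRi (sph_ne_zero u))
  have hcn : Continuous fun u : Sph p => ‖act R⁻¹ (u : Vec p)‖ :=
    ((continuous_act _).comp continuous_subtype_val).norm
  set c : ℝ := Real.Gamma ((p : ℝ) / 2) / (2 * Real.pi ^ ((p : ℝ) / 2)) with hc
  have hc0 : 0 < c := by
    have : 0 < Real.Gamma ((p : ℝ) / 2) := Real.Gamma_pos_of_pos (by positivity)
    positivity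
  -- Up to a constant the density is `g ^ p / p` with `g = 1 / ‖R⁻¹u‖`, the radial function of the
  -- ellipsoid `‖R⁻¹x‖ < 1`, so probabilities are volumes of cones inside that ellipsoid.
  have hdens : ∀ u : Sph p, ENNReal.ofReal (angularGaussianDensity V (u : Vec p)) =
      ENNReal.ofReal (c / |R.det| * p) *
        ENNReal.ofReal ((‖act R⁻¹ (u : Vec p)‖⁻¹) ^ p / p) := by
    intro u
    rw [← ENNReal.ofReal_mul (by positivity), angularGaussianDensity, hq, hdet]
    congr 1
    have : (‖act R⁻¹ (u : Vec p)‖ ^ 2) ^ (-((p : ℝ) / 2)) = (‖act R⁻¹ (u : Vec p)‖⁻¹) ^ p := by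
      rw [← Real.rpow_natCast _ 2, ← Real.rpow_mul (hn u).le, inv_pow, ← Real.rpow_natCast _ p,
        ← Real.rpow_neg (hn u).le]
      congr 1; push_cast; ring
    rw [this, hc]
    have := abs_pos.2 hR
    field_simp
  ext s hs
  rw [Measure.map_apply hm hs, angularGaussian, withDensity_apply _ (hm hs)]
  simp_rw [hdens]
  have hgm : Measurable fun u : Sph p => ‖act R⁻¹ (u : Vec p)‖⁻¹ := hcn.measurable.inv
  rw [lintegral_const_mul _ ((hgm.pow_const p).div_const _).ennreal_ofReal,
    lintegral_toSphere_cone hp (hm hs) hgm (fun u => inv_pos.2 (hn u)), sphUnif, Measure.smul_apply,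
    Measure.toSphere_apply' _ hs]
  -- The part of the ellipsoid over the preimage of `s` is the image under `R` of the unit cone over
  -- `s`; the factor `|det R|` then cancels the one in the density.
  have hset : {x : Vec p | ∃ u ∈ sphMap R⁻¹ ⁻¹' s, ∃ r : ℝ, 0 < r ∧
      r < ‖act R⁻¹ (u : Vec p)‖⁻¹ ∧ x = r • (u : Vec p)} =
      act R '' (Set.Ioo (0 : ℝ) 1 • (((↑) : Sph p → Vec p) '' s)) := by
    ext x
    simp only [Set.mem_ofPred_eq, Set.mem_image, Set.mem_smul]
    constructor
    · rintro ⟨u, hu, r, hr0, hr, rfl⟩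
      refine ⟨act R⁻¹ (r • (u : Vec p)), ⟨r * ‖act R⁻¹ (u : Vec p)‖, ⟨?_, ?_⟩, _,
        ⟨sphMap R⁻¹ u, hu, rfl⟩, ?_⟩, ?_⟩
      · exact mul_pos hr0 (hn u)
      · rwa [← lt_inv_mul_iff₀' (hn u), mul_one]
      · rw [coe_sphMap hRi, smul_smul, mul_assoc, mul_inv_cancel₀ (hn u).ne', mul_one, act_smul]
      · rw [act_act, hRR, act_one]
    · rintro ⟨_, ⟨t, ht, _, ⟨w, hw, rfl⟩, rfl⟩, rfl⟩
      have hnR : 0 < ‖act R (w : Vec p)‖ := norm_pos_iff.2 (act_ne_zero hR (sph_ne_zero w))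
      have hu : act R⁻¹ (sphMap R w : Vec p) = ‖act R (w : Vec p)‖⁻¹ • (w : Vec p) := by
        rw [coe_sphMap hR, act_smul, act_act, hRR', act_one]
      have hu' : ‖act R⁻¹ (sphMap R w : Vec p)‖ = ‖act R (w : Vec p)‖⁻¹ := by
        rw [hu, norm_smul, norm_sph, mul_one, norm_inv, norm_norm]
      refine ⟨sphMap R w, ?_, t * ‖act R (w : Vec p)‖, mul_pos ht.1 hnR, ?_, ?_⟩
      · have : sphMap R⁻¹ (sphMap R w) = w := by
          apply Subtype.ext
          rw [coe_sphMap hRi, hu', hu, smul_smul, inv_inv, mul_inv_cancel₀ hnR.ne', one_smul]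
        rwa [Set.mem_preimage, this]
      · rw [hu', inv_inv]
        exact mul_lt_of_lt_one_left hnR ht.2
      · rw [act_smul, coe_sphMap hR, smul_smul, mul_assoc, mul_inv_cancel₀ hnR.ne', mul_one]
  rw [hset, volume_image_act, ← hc, ← mul_assoc, ← ENNReal.ofReal_mul (by positivity)]
  simp only [finrank_euclideanSpace, Fintype.card_fin, smul_eq_mul]
  rw [← ENNReal.ofReal_natCast, ← mul_assoc, ← ENNReal.ofReal_mul (by positivity)]
  congr 2
  have := abs_pos.2 hR
  field_simp

/-! ### Moments of the uniform distribution -/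

/-- The restriction of a linear isometry to the unit sphere. -/
def sphIsom {p : ℕ} (g : Vec p ≃ₗᵢ[ℝ] Vec p) (u : Sph p) : Sph p :=
  ⟨g u, by rw [mem_sphere_zero_iff_norm, g.norm_map, norm_sph]⟩

lemma continuous_sphIsom {p : ℕ} (g : Vec p ≃ₗᵢ[ℝ] Vec p) : Continuous (sphIsom g) :=
  Continuous.subtype_mk (g.continuous.comp continuous_subtype_val) _

-- Surface measure is the volume of the solid cone over a set, up to a factor, and an isometry
-- carries cones to cones of equal volume.
open scoped Pointwise in
lemma map_sphIsom_sphUnif {p : ℕ} (g : Vec p ≃ₗᵢ[ℝ] Vec p) :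
    (sphUnif p).map (sphIsom g) = sphUnif p := by
  have hm := (continuous_sphIsom g).measurable
  rw [sphUnif, Measure.map_smul]
  congr 1
  ext s hs
  rw [Measure.map_apply hm hs, Measure.toSphere_apply' _ (hm hs), Measure.toSphere_apply' _ hs]
  congr 1
  have hset : (Set.Ioo (0 : ℝ) 1 • (((↑) : Sph p → Vec p) '' (sphIsom g ⁻¹' s))) =
      g ⁻¹' (Set.Ioo (0 : ℝ) 1 • (((↑) : Sph p → Vec p) '' s)) := by
    ext x
    simp only [Set.mem_smul, Set.mem_image, Set.mem_preimage]
    constructor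
    · rintro ⟨t, ht, _, ⟨u, hu, rfl⟩, rfl⟩
      exact ⟨t, ht, _, ⟨_, hu, rfl⟩, by simp [sphIsom]⟩
    · rintro ⟨t, ht, _, ⟨u, hu, rfl⟩, hx⟩
      refine ⟨t, ht, _, ⟨sphIsom g.symm u, ?_, rfl⟩, ?_⟩
      · have : sphIsom g (sphIsom g.symm u) = u := by
          apply Subtype.ext; simp [sphIsom]
        rwa [this]
      · apply g.injective
        simp [sphIsom, hx]
  rw [hset]
  exact MeasurePreserving.measure_preimage_equiv (f := g.toHomeomorph.toMeasurableEquiv)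
    g.measurePreserving _

lemma integrable_sphUnif {p : ℕ} (hp : p ≠ 0) {f : Sph p → ℝ} (hf : Continuous f) :
    Integrable f (sphUnif p) := by
  have := isProbabilityMeasure_sphUnif hp
  exact hf.integrable_of_hasCompactSupport (HasCompactSupport.of_compactSpace f)

/-- The reflection in the hyperplane orthogonal to `x - y` sends `x` to `y` when their norms agree,
and it preserves the uniform law. -/
lemma integral_comp_inner_sphUnif {p : ℕ} {F : ℝ → ℝ} (hF : Continuous F) {x y : Vec p}
    (hxy : ‖x‖ = ‖y‖) :
    ∫ w, F (inner ℝ (w : Vec p) x) ∂sphUnif p = ∫ w, F (inner ℝ (w : Vec p) y) ∂sphUnif p := by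
  set g := (Submodule.span ℝ {x - y})ᗮ.reflection
  have hg : g x = y := Submodule.reflection_sub hxy
  conv_rhs => rw [← map_sphIsom_sphUnif g]
  rw [integral_map (continuous_sphIsom g).aemeasurable]
  · congr 1; ext w
    rw [← hg]
    simp only [sphIsom]
    rw [g.inner_map_map]
  · exact (hF.comp (continuous_subtype_val.inner continuous_const)).aestronglyMeasurable

@[fun_prop]
lemma continuous_inner_sph {p : ℕ} (x : Vec p) :
    Continuous fun w : Sph p => (inner ℝ (w : Vec p) x : ℝ) :=
  continuous_subtype_val.inner continuous_const

lemma integral_inner_pow_sphUnif {p : ℕ} (i : Fin p) (k : ℕ) (x : Vec p) :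
    ∫ w, (inner ℝ (w : Vec p) x) ^ k ∂sphUnif p =
      ‖x‖ ^ k * ∫ w, (inner ℝ (w : Vec p) (EuclideanSpace.single i 1)) ^ k ∂sphUnif p := by
  rw [integral_comp_inner_sphUnif (F := fun t => t ^ k) (by fun_prop)
    (y := ‖x‖ • EuclideanSpace.single i (1 : ℝ)) (by simp [norm_smul]), ← integral_const_mul]
  simp_rw [real_inner_smul_right, mul_pow]

lemma inner_single_one {p : ℕ} (x : Vec p) (i : Fin p) :
    inner ℝ x (EuclideanSpace.single i (1 : ℝ)) = x i := by
  rw [EuclideanSpace.inner_single_right]; simp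

lemma inner_single_single {p : ℕ} (i j : Fin p) :
    inner ℝ (EuclideanSpace.single i (1 : ℝ)) (EuclideanSpace.single j (1 : ℝ)) =
      if i = j then (1 : ℝ) else 0 := by
  rw [inner_single_one, PiLp.single_apply]; simp only [eq_comm]

lemma sum_sq_sph {p : ℕ} (w : Sph p) : ∑ i, (w : Vec p) i ^ 2 = 1 := by
  have := EuclideanSpace.real_norm_sq_eq (w : Vec p)
  rw [norm_sph] at this
  simpa using this.symm

lemma integral_inner_sq_sphUnif {p : ℕ} (hp : p ≠ 0) (x : Vec p) :
    ∫ w, (inner ℝ (w : Vec p) x) ^ 2 ∂sphUnif p = ‖x‖ ^ 2 / p := by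
  have := isProbabilityMeasure_sphUnif hp
  let i₀ : Fin p := ⟨0, Nat.pos_of_ne_zero hp⟩
  have hp' : (p : ℝ) ≠ 0 := by exact_mod_cast hp
  rw [integral_inner_pow_sphUnif i₀ 2 x]
  set c := ∫ w, (inner ℝ (w : Vec p) (EuclideanSpace.single i₀ 1)) ^ 2 ∂sphUnif p with hc
  have h : ∀ i : Fin p, ∫ w, (w : Vec p) i ^ 2 ∂sphUnif p = c := by
    intro i
    have := integral_inner_pow_sphUnif i₀ 2 (EuclideanSpace.single i (1 : ℝ))
    rw [← hc] at this
    simpa [inner_single_one] using this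
  have h1 : ∑ i : Fin p, ∫ w, (w : Vec p) i ^ 2 ∂sphUnif p = 1 := by
    rw [← integral_finsetSum]
    · simp_rw [sum_sq_sph]; simp
    · intro i _
      exact integrable_sphUnif hp (by fun_prop)
  simp only [h, Finset.sum_const, Finset.card_univ, Fintype.card_fin, nsmul_eq_mul] at h1
  have : c = 1 / p := by field_simp; linarith
  rw [this]; ring

lemma integral_inner_mul_inner_sphUnif {p : ℕ} (hp : p ≠ 0) (x y : Vec p) :
    ∫ w, inner ℝ (w : Vec p) x * inner ℝ (w : Vec p) y ∂sphUnif p = inner ℝ x y / p := by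
  have h : ∀ w : Sph p, inner ℝ (w : Vec p) x * inner ℝ (w : Vec p) y =
      1 / 4 * (inner ℝ (w : Vec p) (x + y) ^ 2 - inner ℝ (w : Vec p) (x - y) ^ 2) := by
    intro w; rw [inner_add_right, inner_sub_right]; ring
  simp_rw [h]
  rw [integral_const_mul, integral_sub, integral_inner_sq_sphUnif hp, integral_inner_sq_sphUnif hp,
    norm_add_sq_real, norm_sub_sq_real]
  · ring
  all_goals exact integrable_sphUnif hp (by fun_prop)

/-- Polarization: `12 s²t² = (s+t)⁴ + (s-t)⁴ - 2s⁴ - 2t⁴`. Each fourth power has a moment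
proportional to the fourth power of a norm, with one common constant still to be found. -/
lemma integral_inner_sq_mul_inner_sq_aux {p : ℕ} (hp : p ≠ 0) (i : Fin p) (x y : Vec p) :
    ∫ w, inner ℝ (w : Vec p) x ^ 2 * inner ℝ (w : Vec p) y ^ 2 ∂sphUnif p =
      (‖x‖ ^ 2 * ‖y‖ ^ 2 + 2 * inner ℝ x y ^ 2) / 3 *
        ∫ w, (inner ℝ (w : Vec p) (EuclideanSpace.single i 1)) ^ 4 ∂sphUnif p := by
  have h : ∀ w : Sph p, inner ℝ (w : Vec p) x ^ 2 * inner ℝ (w : Vec p) y ^ 2 =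
      1 / 12 * ((inner ℝ (w : Vec p) (x + y) ^ 4 + inner ℝ (w : Vec p) (x - y) ^ 4) -
        (2 * inner ℝ (w : Vec p) x ^ 4 + 2 * inner ℝ (w : Vec p) y ^ 4)) := by
    intro w; rw [inner_add_right, inner_sub_right]; ring
  simp_rw [h]
  rw [integral_const_mul, integral_sub, integral_add, integral_add, integral_const_mul,
    integral_const_mul, integral_inner_pow_sphUnif i, integral_inner_pow_sphUnif i 4 (x - y),
    integral_inner_pow_sphUnif i 4 x, integral_inner_pow_sphUnif i 4 y]
  · have h1 : ‖x + y‖ ^ 4 = (‖x + y‖ ^ 2) ^ 2 := by ring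
    have h2 : ‖x - y‖ ^ 4 = (‖x - y‖ ^ 2) ^ 2 := by ring
    rw [h1, h2, norm_add_sq_real, norm_sub_sq_real]
    ring
  all_goals exact integrable_sphUnif hp (by fun_prop)

lemma integral_fourth_moment {p : ℕ} (hp : p ≠ 0) (i₀ : Fin p) :
    ∫ w, (inner ℝ (w : Vec p) (EuclideanSpace.single i₀ 1)) ^ 4 ∂sphUnif p =
      3 / (p * (p + 2)) := by
  have := isProbabilityMeasure_sphUnif hp
  have hp' : (0 : ℝ) < p := by exact_mod_cast Nat.pos_of_ne_zero hp
  set c := ∫ w, (inner ℝ (w : Vec p) (EuclideanSpace.single i₀ 1)) ^ 4 ∂sphUnif p with hc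
  have h : ∀ i j : Fin p, ∫ w, (w : Vec p) i ^ 2 * (w : Vec p) j ^ 2 ∂sphUnif p =
      (1 + 2 * (if i = j then 1 else 0)) / 3 * c := by
    intro i j
    have := integral_inner_sq_mul_inner_sq_aux hp i₀ (EuclideanSpace.single i (1 : ℝ))
      (EuclideanSpace.single j (1 : ℝ))
    rw [← hc, inner_single_single] at this
    simpa [inner_single_one] using this
  -- The constant is fixed by `(∑ wᵢ²)² = 1`, which gives `c (p² + 2p) / 3 = 1`.
  have h1 : ∑ i : Fin p, ∑ j : Fin p, ∫ w, (w : Vec p) i ^ 2 * (w : Vec p) j ^ 2 ∂sphUnif p = 1 := by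
    have : ∀ i : Fin p, ∑ j : Fin p, ∫ w, (w : Vec p) i ^ 2 * (w : Vec p) j ^ 2 ∂sphUnif p =
        ∫ w, (w : Vec p) i ^ 2 ∂sphUnif p := by
      intro i
      rw [← integral_finsetSum]
      · simp_rw [← Finset.mul_sum, sum_sq_sph, mul_one]
      · intro j _
        exact integrable_sphUnif hp (by fun_prop)
    simp_rw [this]
    rw [← integral_finsetSum]
    · simp_rw [sum_sq_sph]; simp
    · intro i _
      exact integrable_sphUnif hp (by fun_prop)
  simp only [h, ← Finset.sum_mul, ← Finset.sum_div, Finset.sum_add_distrib, ← Finset.mul_sum,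
    Finset.sum_ite_eq, Finset.mem_univ, if_true, Finset.sum_const, Finset.card_univ,
    Fintype.card_fin, nsmul_eq_mul, mul_one] at h1
  field_simp
  nlinarith

lemma integral_inner_sq_mul_inner_sq_sphUnif {p : ℕ} (hp : p ≠ 0) (x y : Vec p) :
    ∫ w, inner ℝ (w : Vec p) x ^ 2 * inner ℝ (w : Vec p) y ^ 2 ∂sphUnif p =
      (‖x‖ ^ 2 * ‖y‖ ^ 2 + 2 * inner ℝ x y ^ 2) / (p * (p + 2)) := by
  rw [integral_inner_sq_mul_inner_sq_aux hp ⟨0, Nat.pos_of_ne_zero hp⟩, integral_fourth_moment hp]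
  ring

/-- Polarization of the previous formula in each pair. The three pairings are those of Wick's
formula, with normalization `p (p + 2)`. -/
lemma integral_inner_mul_four_sphUnif {p : ℕ} (hp : p ≠ 0) (x y z v : Vec p) :
    ∫ w, (inner ℝ (w : Vec p) x * inner ℝ (w : Vec p) y) *
        (inner ℝ (w : Vec p) z * inner ℝ (w : Vec p) v) ∂sphUnif p =
      (inner ℝ x y * inner ℝ z v + inner ℝ x z * inner ℝ y v + inner ℝ x v * inner ℝ y z) /
        (p * (p + 2)) := by
  have h : ∀ w : Sph p, (inner ℝ (w : Vec p) x * inner ℝ (w : Vec p) y) *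
        (inner ℝ (w : Vec p) z * inner ℝ (w : Vec p) v) =
      1 / 16 * (((inner ℝ (w : Vec p) (x + y) ^ 2 * inner ℝ (w : Vec p) (z + v) ^ 2) +
        (inner ℝ (w : Vec p) (x - y) ^ 2 * inner ℝ (w : Vec p) (z - v) ^ 2)) -
        ((inner ℝ (w : Vec p) (x + y) ^ 2 * inner ℝ (w : Vec p) (z - v) ^ 2) +
        (inner ℝ (w : Vec p) (x - y) ^ 2 * inner ℝ (w : Vec p) (z + v) ^ 2))) := by
    intro w; simp only [inner_add_right, inner_sub_right]; ring
  simp_rw [h]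
  rw [integral_const_mul, integral_sub, integral_add, integral_add]
  · simp only [integral_inner_sq_mul_inner_sq_sphUnif hp]
    simp only [norm_add_sq_real, norm_sub_sq_real,
      inner_add_right, inner_sub_right, inner_add_left, inner_sub_left]
    ring
  all_goals exact integrable_sphUnif hp (by fun_prop)

/-- The quadratic form `w' A w` on the sphere. -/
def qf {p : ℕ} (A : Mat p) (w : Sph p) : ℝ := bilin (w : Vec p) A (w : Vec p)

lemma qf_eq_sum {p : ℕ} (A : Mat p) (w : Sph p) :
    qf A w = ∑ i, ∑ j, A i j * ((w : Vec p) i * (w : Vec p) j) := by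
  simp only [qf, bilin, dotProduct, Matrix.mulVec, Finset.mul_sum]
  exact Finset.sum_congr rfl fun i _ => Finset.sum_congr rfl fun j _ => by ring

@[fun_prop]
lemma continuous_qf {p : ℕ} (A : Mat p) : Continuous (qf A) := by
  have : qf A = fun w : Sph p => ∑ i, ∑ j, A i j * ((w : Vec p) i * (w : Vec p) j) :=
    funext (qf_eq_sum A)
  rw [this]; fun_prop

lemma integral_qf {p : ℕ} (hp : p ≠ 0) (A : Mat p) :
    ∫ w, qf A w ∂sphUnif p = A.trace / p := by
  have h : ∀ i j : Fin p, ∫ w, (w : Vec p) i * (w : Vec p) j ∂sphUnif p =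
      (if i = j then 1 else 0) / p := by
    intro i j
    have := integral_inner_mul_inner_sphUnif hp (EuclideanSpace.single i (1 : ℝ))
      (EuclideanSpace.single j (1 : ℝ))
    simp only [inner_single_single] at this
    simpa only [inner_single_one] using this
  simp_rw [qf_eq_sum]
  rw [integral_finsetSum _ fun i _ => integrable_sphUnif hp (by fun_prop)]
  have h2 : ∀ i : Fin p, ∫ w, ∑ j, A i j * ((w : Vec p) i * (w : Vec p) j) ∂sphUnif p =
      ∑ j, A i j * ((if i = j then 1 else 0) / p) := by
    intro i
    rw [integral_finsetSum _ fun j _ => integrable_sphUnif hp (by fun_prop)]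
    simp_rw [integral_const_mul, h]
  simp_rw [h2]
  simp [Matrix.trace, div_eq_mul_inv, ← Finset.sum_mul]

/-- The three traces are the three pairings of four indices. No symmetry of `A` is assumed, because
the test matrices for `vec Υ` are arbitrary. -/
lemma integral_qf_sq {p : ℕ} (hp : p ≠ 0) (A : Mat p) :
    ∫ w, qf A w ^ 2 ∂sphUnif p =
      (A.trace ^ 2 + (Aᵀ * A).trace + (A * A).trace) / (p * (p + 2)) := by
  have h : ∀ i j k l : Fin p, ∫ w, ((w : Vec p) i * (w : Vec p) j) *
      ((w : Vec p) k * (w : Vec p) l) ∂sphUnif p =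
      ((if i = j then 1 else 0) * (if k = l then 1 else 0) +
        (if i = k then 1 else 0) * (if j = l then 1 else 0) +
        (if i = l then 1 else 0) * (if j = k then 1 else 0)) / (p * (p + 2)) := by
    intro i j k l
    have := integral_inner_mul_four_sphUnif hp (EuclideanSpace.single i (1 : ℝ))
      (EuclideanSpace.single j (1 : ℝ)) (EuclideanSpace.single k (1 : ℝ))
      (EuclideanSpace.single l (1 : ℝ))
    simp only [inner_single_single] at this
    simpa only [inner_single_one] using this
  have h1 : ∀ w : Sph p, qf A w ^ 2 = ∑ z : (Fin p × Fin p) × (Fin p × Fin p),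
      A z.1.1 z.1.2 * A z.2.1 z.2.2 * (((w : Vec p) z.1.1 * (w : Vec p) z.1.2) *
      ((w : Vec p) z.2.1 * (w : Vec p) z.2.2)) := by
    intro w
    rw [qf_eq_sum, sq, ← Fintype.sum_prod_type', Fintype.sum_mul_sum, ← Fintype.sum_prod_type']
    exact Finset.sum_congr rfl fun z _ => by ring
  simp_rw [h1]
  rw [integral_finsetSum _ fun i _ => integrable_sphUnif hp (by fun_prop)]
  simp_rw [integral_const_mul, h]
  rw [Fintype.sum_prod_type, Fintype.sum_prod_type]
  simp_rw [Fintype.sum_prod_type]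
  simp_rw [← mul_div_assoc, ← Finset.sum_div, mul_add, Finset.sum_add_distrib]
  congr 2
  · congr 1
    · simp [Matrix.trace, sq, Finset.sum_mul_sum]
    · simp only [Matrix.trace, Matrix.diag, Matrix.mul_apply, Matrix.transpose_apply]
      rw [Finset.sum_comm]
      refine Finset.sum_congr rfl fun i _ => Finset.sum_congr rfl fun j _ => ?_
      simp
  · simp only [Matrix.trace, Matrix.diag, Matrix.mul_apply]
    refine Finset.sum_congr rfl fun i _ => Finset.sum_congr rfl fun j _ => ?_
    simp

/-! ### Central limit theorem -/

lemma tendsto_charFun_inv_sqrt_pow_of_variance {Ω : Type*} [MeasurableSpace Ω] {P : Measure Ω}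
    [IsProbabilityMeasure P] {X : Ω → ℝ} (hX : AEMeasurable X P)
    (hX2 : Integrable (fun ω => X ω ^ 2) P) (h0 : ∫ ω, X ω ∂P = 0) {v : ℝ}
    (hv : ∫ ω, X ω ^ 2 ∂P = v) :
    Tendsto (fun n : ℕ => charFun (P.map X) ((√n)⁻¹) ^ n) atTop
      (𝓝 (Complex.exp (-(v : ℂ) / 2))) := by
  have hv0 : 0 ≤ v := hv ▸ integral_nonneg fun ω => sq_nonneg _
  rcases hv0.eq_or_lt with hv0 | hv0
  -- A variable of zero variance cannot be standardized. This case does occur, since the limiting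
  -- covariances are singular.
  · have h1 : X =ᵐ[P] fun _ => (0 : ℝ) := by
      have := (integral_eq_zero_iff_of_nonneg (fun ω => sq_nonneg (X ω)) hX2).1 (by rw [hv, hv0])
      filter_upwards [this] with ω hω
      simpa using hω
    rw [Measure.map_congr h1, Measure.map_const, measure_univ, one_smul]
    simp [charFun_dirac, ← hv0]
  · have hs : √v ≠ 0 := (Real.sqrt_pos.2 hv0).ne'
    have h := tendsto_charFun_inv_sqrt_mul_pow (P := P) (X := fun ω => (√v)⁻¹ * X ω)
      (hX.const_mul _) (by rw [integral_const_mul, h0, mul_zero])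
      (by
        simp only [Pi.pow_apply, mul_pow]
        rw [integral_const_mul, hv, inv_pow, Real.sq_sqrt hv0.le, inv_mul_cancel₀ hv0.ne']) (√v)
    have he : Complex.exp (-(√v : ℂ) ^ 2 / 2) = Complex.exp (-(v : ℂ) / 2) := by
      rw [← Complex.ofReal_pow, Real.sq_sqrt hv0.le]
    rw [he] at h
    refine h.congr fun n => ?_
    rw [charFun_map_mul_comp hX]
    congr 2
    field_simp

/-- The law of an i.i.d. uniform sample on the sphere. -/
def unifSample (p n : ℕ) : Measure (Fin n → Sph p) := Measure.pi fun _ => sphUnif p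

lemma isProbabilityMeasure_unifSample {p : ℕ} (hp : p ≠ 0) (n : ℕ) :
    IsProbabilityMeasure (unifSample p n) := by
  have := isProbabilityMeasure_sphUnif hp
  rw [unifSample]; infer_instance

/-- Positive semidefiniteness is what makes `multivariateGaussian` have the expected characteristic
function; being a matrix of second moments provides it. -/
lemma posSemidef_of_integral_sq {p : ℕ} {ι : Type*} [Fintype ι] {h : Sph p → EuclideanSpace ℝ ι}
    {C : Matrix ι ι ℝ} (hC : C.IsHermitian)
    (h2 : ∀ t, ∫ w, (inner ℝ (h w) t) ^ 2 ∂sphUnif p = t.ofLp ⬝ᵥ C *ᵥ t.ofLp) :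
    C.PosSemidef := by
  refine Matrix.PosSemidef.of_dotProduct_mulVec_nonneg hC fun x => ?_
  rw [star_trivial]
  exact (integral_nonneg fun w => sq_nonneg _).trans_eq (h2 (WithLp.toLp 2 x))

/-- Pairing with `t` reduces to real variables, and independence turns the characteristic function
of the sum into a power. -/
lemma charFun_map_normalized_sum {p : ℕ} (hp : p ≠ 0) {ι : Type*} [Fintype ι]
    {h : Sph p → EuclideanSpace ℝ ι} (hh : Continuous h) (n : ℕ) (t : EuclideanSpace ℝ ι) :
    charFun ((unifSample p n).map fun w => (√n)⁻¹ • ∑ i, h (w i)) t =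
      charFun ((sphUnif p).map fun w => (inner ℝ (h w) t : ℝ)) ((√n)⁻¹) ^ n := by
  have := isProbabilityMeasure_sphUnif hp
  have hP := isProbabilityMeasure_unifSample hp n
  have hit : Continuous fun w => (inner ℝ (h w) t : ℝ) := hh.inner continuous_const
  have hcont : Continuous fun w : Fin n → Sph p => (√n)⁻¹ • ∑ i, h (w i) := by fun_prop
  have hexp : Continuous fun x : EuclideanSpace ℝ ι =>
      Complex.exp ((inner ℝ x t : ℝ) * Complex.I) := by fun_prop
  have hexp' : Continuous fun x : ℝ => Complex.exp (((√n)⁻¹ : ℝ) * x * Complex.I) := by fun_prop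
  rw [charFun_apply, charFun_apply_real,
    integral_map hit.measurable.aemeasurable hexp'.aestronglyMeasurable,
    integral_map hcont.measurable.aemeasurable hexp.aestronglyMeasurable]
  have := integral_fintype_prod_eq_pow (ι := Fin n) (μ := sphUnif p)
    (fun w => Complex.exp (((√n)⁻¹ : ℝ) * (inner ℝ (h w) t : ℝ) * Complex.I))
  rw [Fintype.card_fin] at this
  rw [← this]
  refine integral_congr_ae (ae_of_all _ fun w => ?_)
  simp only [← Complex.exp_sum]
  congr 1
  rw [← Finset.sum_mul, real_inner_smul_left, sum_inner]
  push_cast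
  rw [Finset.mul_sum]

/-- Lévy's continuity theorem, with the scalar central limit theorem applied in every direction `t`.
-/
lemma tendsto_integral_normalized_sum {p : ℕ} (hp : p ≠ 0) {ι : Type*} [Fintype ι]
    [DecidableEq ι] {h : Sph p → EuclideanSpace ℝ ι} (hh : Continuous h) {C : Matrix ι ι ℝ}
    (hC : C.IsHermitian) (h1 : ∀ t, ∫ w, inner ℝ (h w) t ∂sphUnif p = 0)
    (h2 : ∀ t, ∫ w, (inner ℝ (h w) t) ^ 2 ∂sphUnif p = t.ofLp ⬝ᵥ C *ᵥ t.ofLp)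
    (f : EuclideanSpace ℝ ι →ᵇ ℝ) :
    Tendsto (fun n : ℕ => ∫ w, f ((√n)⁻¹ • ∑ i, h (w i)) ∂unifSample p n) atTop
      (𝓝 (∫ x, f x ∂multivariateGaussian 0 C)) := by
  have := isProbabilityMeasure_sphUnif hp
  have hP := isProbabilityMeasure_unifSample hp
  have hm : ∀ n : ℕ, AEMeasurable (fun w : Fin n → Sph p => (√n)⁻¹ • ∑ i, h (w i))
      (unifSample p n) := fun n => by
    have hcont : Continuous fun w : Fin n → Sph p => (√n)⁻¹ • ∑ i, h (w i) := by fun_prop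
    exact hcont.measurable.aemeasurable
  have hprob : ∀ n : ℕ,
      IsProbabilityMeasure ((unifSample p n).map fun w => (√n)⁻¹ • ∑ i, h (w i)) := fun n =>
    Measure.isProbabilityMeasure_map (hm n)
  have key := (ProbabilityMeasure.tendsto_iff_tendsto_charFun
    (μ := fun n : ℕ => ⟨(unifSample p n).map fun w => (√n)⁻¹ • ∑ i, h (w i), hprob n⟩)
    (μ₀ := ⟨multivariateGaussian 0 C, inferInstance⟩)).2 (by
      intro t
      have hit : Continuous fun w => (inner ℝ (h w) t : ℝ) := hh.inner continuous_const
      have hlim := tendsto_charFun_inv_sqrt_pow_of_variance (P := sphUnif p)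
        hit.measurable.aemeasurable (integrable_sphUnif hp (hit.pow 2)) (h1 t) (h2 t)
      simp only [ProbabilityMeasure.coe_mk]
      rw [charFun_multivariateGaussian (posSemidef_of_integral_sq hC h2)]
      simp only [charFun_map_normalized_sum hp hh]
      simpa [neg_div] using hlim)
  refine (ProbabilityMeasure.tendsto_iff_forall_integral_tendsto.1 key f).congr fun n => ?_
  simp only [ProbabilityMeasure.coe_mk]
  rw [integral_map (hm n) f.continuous.aestronglyMeasurable]

/-! ### Weak law for triangular arrays of small summands -/

/-- Chebyshev's inequality: the variance of the sum is at most `n b² = (√n b)²`, and its mean tends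
to zero. Half of `ε` is spent on the mean and half on the deviation. -/
lemma isLittleOP_sum_of_small {p : ℕ} (hp : p ≠ 0) {f : ℕ → Sph p → ℝ}
    (hf : ∀ᶠ n in atTop, Continuous (f n)) {b : ℕ → ℝ}
    (hb : ∀ᶠ n in atTop, ∀ w, |f n w| ≤ b n) (hb0 : Tendsto (fun n : ℕ => √n * b n) atTop (𝓝 0))
    (hmean : Tendsto (fun n : ℕ => (n : ℝ) * ∫ w, f n w ∂sphUnif p) atTop (𝓝 0)) :
    IsLittleOP (fun n => unifSample p n) fun n w => ∑ i, f n (w i) := by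
  have := isProbabilityMeasure_sphUnif hp
  have hP := isProbabilityMeasure_unifSample hp
  intro ε hε
  have hbd : ∀ᶠ n : ℕ in atTop, unifSample p n {w | ε ≤ |∑ i, f n (w i)|} ≤
      ENNReal.ofReal ((√n * b n) ^ 2 / (ε / 2) ^ 2) := by
    have hsm := (Metric.tendsto_nhds.1 hmean) (ε / 2) (by positivity)
    filter_upwards [hf, hb, hsm] with n hfn hbn hn
    rw [Real.dist_eq, sub_zero] at hn
    have hL : MemLp (f n) 2 (sphUnif p) :=
      MemLp.of_bound hfn.aestronglyMeasurable (b n) (ae_of_all _ hbn)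
    have hLi : ∀ i : Fin n, MemLp (fun w : Fin n → Sph p => f n (w i)) 2 (unifSample p n) :=
      fun i => MemLp.of_bound (hfn.comp (continuous_apply i)).aestronglyMeasurable (b n) (ae_of_all _ fun w => hbn (w i))
    have hS : MemLp (fun w : Fin n → Sph p => ∑ i, f n (w i)) 2 (unifSample p n) :=
      memLp_finsetSum _ fun i _ => hLi i
    have hmeanS : ∫ w, ∑ i, f n (w i) ∂unifSample p n = n * ∫ w, f n w ∂sphUnif p := by
      rw [integral_finsetSum _ fun i _ => (hLi i).integrable (by norm_num)]
      have : ∀ i : Fin n, ∫ w, f n (w i) ∂unifSample p n = ∫ w, f n w ∂sphUnif p := fun i =>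
        integral_comp_eval (μ := fun _ : Fin n => sphUnif p) (i := i) hfn.aestronglyMeasurable
      simp [this]
    have hvar : Var[fun w : Fin n → Sph p => ∑ i, f n (w i); unifSample p n] ≤ (√n * b n) ^ 2 := by
      have h1 := variance_sum_pi (μ := fun _ : Fin n => sphUnif p) (X := fun _ => f n)
        (fun _ => hL)
      have h2 : (∑ i : Fin n, fun w : Fin n → Sph p => f n (w i)) =
          fun w => ∑ i, f n (w i) := by ext w; simp
      rw [h2] at h1
      rw [unifSample, h1, mul_pow, Real.sq_sqrt (Nat.cast_nonneg n)]
      -- Popoviciu's bound on the interval `[-b, b]`.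
      have h3 : Var[f n; sphUnif p] ≤ ((b n - (-b n)) / 2) ^ 2 :=
        variance_le_sq_of_bounded (ae_of_all _ fun w => abs_le.1 (hbn w))
          hfn.measurable.aemeasurable
      have h4 : ((b n - (-b n)) / 2) ^ 2 = b n ^ 2 := by ring
      rw [h4] at h3
      simp only [Finset.sum_const, Finset.card_univ, Fintype.card_fin, nsmul_eq_mul]
      gcongr
    have hch := meas_ge_le_variance_div_sq (μ := unifSample p n) hS (c := ε / 2) (by positivity)
    refine (measure_mono ?_).trans (hch.trans (ENNReal.ofReal_le_ofReal (by gcongr)))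
    intro w hw
    simp only [Set.mem_ofPred_eq] at hw ⊢
    rw [hmeanS]
    have := abs_sub_abs_le_abs_sub (∑ i, f n (w i)) (n * ∫ w, f n w ∂sphUnif p)
    linarith
  refine tendsto_of_tendsto_of_tendsto_of_le_of_le' tendsto_const_nhds ?_
    (Eventually.of_forall fun n => zero_le) hbd
  have h3 : Tendsto (fun n : ℕ => (√n * b n) ^ 2 / (ε / 2) ^ 2) atTop (𝓝 0) := by
    simpa using (hb0.pow 2).div_const ((ε / 2) ^ 2)
  simpa using ENNReal.tendsto_ofReal h3

/-! ### The entrywise `ℓ¹` size of a matrix -/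

/-- The sum of the absolute values of the entries. -/
def entrySum {p : ℕ} (A : Mat p) : ℝ := ∑ i, ∑ j, |A i j|

lemma entrySum_nonneg {p : ℕ} (A : Mat p) : 0 ≤ entrySum A :=
  Finset.sum_nonneg fun _ _ => Finset.sum_nonneg fun _ _ => abs_nonneg _

lemma entrySum_add_le {p : ℕ} (A B : Mat p) : entrySum (A + B) ≤ entrySum A + entrySum B := by
  simp only [entrySum, ← Finset.sum_add_distrib]
  exact Finset.sum_le_sum fun i _ => Finset.sum_le_sum fun j _ => abs_add_le _ _

lemma entrySum_smul {p : ℕ} (c : ℝ) (A : Mat p) : entrySum (c • A) = |c| * entrySum A := by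
  simp [entrySum, Finset.mul_sum, abs_mul]

lemma abs_coord_sph_le {p : ℕ} (w : Sph p) (i : Fin p) : |(w : Vec p) i| ≤ 1 := by
  have := PiLp.norm_apply_le (w : Vec p) i
  rwa [norm_sph, Real.norm_eq_abs] at this

lemma abs_qf_le {p : ℕ} (A : Mat p) (w : Sph p) : |qf A w| ≤ entrySum A := by
  rw [qf_eq_sum]
  refine (Finset.abs_sum_le_sum_abs _ _).trans (Finset.sum_le_sum fun i _ => ?_)
  refine (Finset.abs_sum_le_sum_abs _ _).trans (Finset.sum_le_sum fun j _ => ?_)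
  rw [abs_mul, abs_mul]
  exact mul_le_of_le_one_right (abs_nonneg _)
    (mul_le_one₀ (abs_coord_sph_le w i) (abs_nonneg _) (abs_coord_sph_le w j))

lemma abs_entry_le {p : ℕ} (A : Mat p) (i j : Fin p) : |A i j| ≤ entrySum A :=
  (Finset.single_le_sum (f := fun j => |A i j|) (fun _ _ => abs_nonneg _)
    (Finset.mem_univ j)).trans
    (Finset.single_le_sum (f := fun i => ∑ j, |A i j|)
      (fun _ _ => Finset.sum_nonneg fun _ _ => abs_nonneg _) (Finset.mem_univ i))

lemma abs_trace_le {p : ℕ} (A : Mat p) : |A.trace| ≤ entrySum A := by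
  refine (Finset.abs_sum_le_sum_abs _ _).trans (Finset.sum_le_sum fun i _ => ?_)
  exact Finset.single_le_sum (f := fun j => |A i j|) (fun _ _ => abs_nonneg _) (Finset.mem_univ i)

lemma abs_trace_mul_le {p : ℕ} (A B : Mat p) : |(A * B).trace| ≤ entrySum A * entrySum B := by
  have h : |(A * B).trace| ≤ ∑ i, ∑ j, |A i j| * |B j i| := by
    refine (Finset.abs_sum_le_sum_abs _ _).trans (Finset.sum_le_sum fun i _ => ?_)
    rw [Matrix.diag_apply, Matrix.mul_apply]
    refine (Finset.abs_sum_le_sum_abs _ _).trans (Finset.sum_le_sum fun j _ => ?_)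
    rw [abs_mul]
  refine h.trans ?_
  rw [entrySum, Finset.sum_mul]
  refine Finset.sum_le_sum fun i _ => ?_
  rw [Finset.sum_mul]
  exact Finset.sum_le_sum fun j _ => mul_le_mul_of_nonneg_left (abs_entry_le B j i) (abs_nonneg _)

lemma qf_add {p : ℕ} (A B : Mat p) (w : Sph p) : qf (A + B) w = qf A w + qf B w := by
  simp [qf, bilin, Matrix.add_mulVec, dotProduct_add]

lemma qf_smul {p : ℕ} (c : ℝ) (A : Mat p) (w : Sph p) : qf (c • A) w = c * qf A w := by
  simp [qf, bilin, Matrix.smul_mulVec]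

lemma tendsto_entrySum_zero {p : ℕ} {A : ℕ → Mat p}
    (h : ∀ i j, Tendsto (fun n => A n i j) atTop (𝓝 0)) :
    Tendsto (fun n => entrySum (A n)) atTop (𝓝 0) := by
  have : Tendsto (fun n => entrySum (A n)) atTop (𝓝 (∑ _i : Fin p, ∑ _j : Fin p, |(0 : ℝ)|)) :=
    tendsto_finsetSum _ fun i _ => tendsto_finsetSum _ fun j _ => (h i j).abs
  simpa using this

/-! ### Second-order expansion of the log-likelihood of a uniform sample -/

lemma abs_log_one_add_sub_le {x : ℝ} (hx : |x| ≤ 1 / 2) : |Real.log (1 + x) - x| ≤ 2 * |x| ^ 2 := by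
  -- The remainder of the series of `log (1 - y)` at `y = -x`; the constant 2 bounds `1 / (1 -
  -- |x|)`.
  have h := Real.abs_log_sub_add_sum_range_le (x := -x) (by rw [abs_neg]; linarith) 1
  have h2 : |x| ^ 2 / (1 - |x|) ≤ 2 * |x| ^ 2 := by
    rw [div_le_iff₀ (by linarith)]
    nlinarith [sq_nonneg |x|]
  simp only [Finset.range_one, Finset.sum_singleton, abs_neg, sub_neg_eq_add] at h
  refine le_trans (le_of_eq ?_) (h.trans h2)
  congr 1; norm_num; ring

lemma abs_log_one_add_sub_add_le {x : ℝ} (hx : |x| ≤ 1 / 2) :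
    |Real.log (1 + x) - (x - x ^ 2 / 2)| ≤ 2 * |x| ^ 3 := by
  have h := Real.abs_log_sub_add_sum_range_le (x := -x) (by rw [abs_neg]; linarith) 2
  have h2 : |x| ^ 3 / (1 - |x|) ≤ 2 * |x| ^ 3 := by
    rw [div_le_iff₀ (by linarith)]
    nlinarith [pow_nonneg (abs_nonneg x) 3]
  simp only [Finset.sum_range_succ, Finset.range_zero, Finset.sum_empty, abs_neg,
    sub_neg_eq_add] at h
  refine le_trans (le_of_eq ?_) (h.trans h2)
  congr 1; norm_num; ring

/-- The trace is of second order: `tr E · (2 + tr E) = tr (E²)`, and the second factor is at least 1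
in absolute value. -/
lemma abs_trace_le_of_det_one {p : ℕ} {E : Mat p}
    (htr : 2 * E.trace = (E * E).trace - E.trace ^ 2) (h1 : entrySum E ≤ 1) :
    |E.trace| ≤ entrySum E ^ 2 := by
  have h2 := abs_trace_mul_le E E
  have h3 := (abs_trace_le E).trans h1
  rw [← sq (entrySum E)] at h2
  have h4 : E.trace * (2 + E.trace) = (E * E).trace := by linarith
  rw [← h4, abs_mul] at h2
  have h5 : 1 ≤ |2 + E.trace| := by
    have := (abs_le.1 h3).1
    exact le_abs.2 (Or.inl (by linarith))
  nlinarith [abs_nonneg E.trace]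

/-- The summands of the difference between the log-likelihood ratio and its quadratic expansion. -/
def expansionError {p : ℕ} (n : ℕ) (E H : Mat p) (w : Sph p) : ℝ :=
  -((p : ℝ) / 2) * Real.log (1 + qf E w) - p / √n * (qf H w - H.trace / p) +
    p / (p + 2) * (H * H).trace / n

lemma continuous_log_one_add_qf {p : ℕ} {E : Mat p} (hE : entrySum E ≤ 1 / 2) :
    Continuous fun w => Real.log (1 + qf E w) := by
  have h : Continuous fun w => 1 + qf E w := by fun_prop
  refine h.log fun w hw => ?_
  have := (abs_le.1 (abs_qf_le E w)).1
  linarith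

lemma continuous_expansionError {p : ℕ} (n : ℕ) {E H : Mat p} (hE : entrySum E ≤ 1 / 2) :
    Continuous (expansionError n E H) := by
  have := continuous_log_one_add_qf hE
  unfold expansionError
  fun_prop

/-- The linear parts in `E` and `H` combine into `√n E + 2H`, of size `e`; what remains (quadratic
part of the logarithm, trace of `E`, constant term) is of order `1/n` before multiplication by `√n`.
-/
lemma abs_expansionError_le {p n : ℕ} (hn : 1 ≤ n) {E H : Mat p} {K e : ℝ}
    (htr : 2 * E.trace = (E * E).trace - E.trace ^ 2)
    (hE : √n * entrySum E ≤ K) (hH : entrySum H ≤ K) (hK : K ≤ √n / 2)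
    (he : entrySum (√n • E + (2 : ℝ) • H) ≤ e) (w : Sph p) :
    √n * |expansionError n E H w| ≤ (p / 2 + 1) * e + (p + 2) * K ^ 2 / √n := by
  have hs : 1 ≤ √n := by rw [Real.one_le_sqrt]; exact_mod_cast hn
  have hs0 : 0 < √n := by linarith
  have hsn : √n * √n = n := Real.mul_self_sqrt (Nat.cast_nonneg n)
  have hE' : entrySum E ≤ K / √n := by rw [le_div_iff₀ hs0]; linarith
  have hK' : K / √n ≤ 1 / 2 := by rw [div_le_iff₀ hs0]; linarith
  have hK0 : 0 ≤ K := (entrySum_nonneg H).trans hH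
  have hx := abs_qf_le E w
  have hlog := abs_log_one_add_sub_le (hx.trans (hE'.trans hK'))
  have hx2 : |qf E w| ^ 2 ≤ (K / √n) ^ 2 := by gcongr; exact hx.trans hE'
  have h1 : |√n * qf E w + 2 * qf H w| ≤ e := by
    rw [← qf_smul, ← qf_smul, ← qf_add]
    exact (abs_qf_le _ _).trans he
  have h2 : |√n * E.trace + 2 * H.trace| ≤ e := by
    have := (abs_trace_le (√n • E + (2 : ℝ) • H)).trans he
    simpa [Matrix.trace_add, Matrix.trace_smul] using this
  have h3 : |E.trace| ≤ (K / √n) ^ 2 :=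
    (abs_trace_le_of_det_one htr (by linarith)).trans
      (pow_le_pow_left₀ (entrySum_nonneg E) hE' 2)
  have h4 : |(H * H).trace| ≤ K ^ 2 := by
    refine (abs_trace_mul_le H H).trans ?_
    nlinarith [entrySum_nonneg H]
  have hp0 : (0 : ℝ) ≤ p := Nat.cast_nonneg p
  have h5 : |p / (p + 2) * (H * H).trace / √n| ≤ K ^ 2 / √n := by
    rw [abs_div, abs_of_pos hs0, abs_mul, abs_of_nonneg (by positivity : (0 : ℝ) ≤ p / (p + 2))]
    gcongr
    have : (p : ℝ) / (p + 2) ≤ 1 := by rw [div_le_one (by positivity)]; linarith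
    exact (mul_le_mul this h4 (abs_nonneg _) zero_le_one).trans_eq (one_mul _)
  have hpp : (p : ℝ) / √n * (H.trace / p) = p * (H.trace / p) / √n := by ring
  have hpt : (p : ℝ) * (H.trace / p) = H.trace := by
    rcases Nat.eq_zero_or_pos p with rfl | hp
    · simp [Matrix.trace]
    · have : (p : ℝ) ≠ 0 := by exact_mod_cast hp.ne'
      field_simp
  have key : √n * expansionError n E H w =
      -((p : ℝ) / 2) * (√n * qf E w + 2 * qf H w) -
      p / 2 * (√n * (Real.log (1 + qf E w) - qf E w)) +
      ((√n * E.trace + 2 * H.trace) / 2 - √n * E.trace / 2) +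
      p / (p + 2) * (H * H).trace / √n := by
    rw [expansionError, mul_sub, hpp, hpt]
    generalize √(n : ℝ) = s at hsn hs0
    rw [← hsn]
    field_simp
    ring
  have h6 : √n * |Real.log (1 + qf E w) - qf E w| ≤ 2 * K ^ 2 / √n := by
    calc √n * |Real.log (1 + qf E w) - qf E w| ≤ √n * (2 * (K / √n) ^ 2) := by gcongr; linarith
      _ = 2 * K ^ 2 / √n := by field_simp
  have h7 : √n * |E.trace| ≤ K ^ 2 / √n := by
    calc √n * |E.trace| ≤ √n * (K / √n) ^ 2 := by gcongr
      _ = K ^ 2 / √n := by field_simp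
  have h8 : √n * |expansionError n E H w| = |√n * expansionError n E H w| := by
    rw [abs_mul, abs_of_pos hs0]
  rw [h8, key]
  have t1 : |(-((p : ℝ) / 2)) * (√n * qf E w + 2 * qf H w)| ≤ p / 2 * e := by
    rw [abs_mul, abs_neg, abs_of_nonneg (by positivity : (0 : ℝ) ≤ p / 2)]
    gcongr
  have t2 : |(p : ℝ) / 2 * (√n * (Real.log (1 + qf E w) - qf E w))| ≤ p / 2 * (2 * K ^ 2 / √n) := by
    rw [abs_mul, abs_mul, abs_of_pos hs0, abs_of_nonneg (by positivity : (0 : ℝ) ≤ p / 2)]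
    gcongr
  have t3 : |(√n * E.trace + 2 * H.trace) / 2 - √n * E.trace / 2| ≤ e / 2 + K ^ 2 / √n / 2 := by
    refine (abs_sub _ _).trans (add_le_add ?_ ?_)
    · rw [abs_div, abs_two]; gcongr
    · rw [abs_div, abs_two, abs_mul, abs_of_pos hs0]; gcongr
  have he0 : 0 ≤ e := (abs_nonneg _).trans h1
  have hKs : 0 ≤ K ^ 2 / √n := by positivity
  refine (abs_add_le _ _).trans ((add_le_add ((abs_add_le _ _).trans
    (add_le_add ((abs_sub _ _).trans (add_le_add t1 t2)) t3)) h5).trans ?_)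
  have e1 : (p : ℝ) / 2 * (2 * K ^ 2 / √n) = p * (K ^ 2 / √n) := by ring
  have e2 : (p + 2) * K ^ 2 / √n = p * (K ^ 2 / √n) + 2 * (K ^ 2 / √n) := by ring
  rw [e1, e2]
  linarith

/-- A sup bound alone is too weak for the mean, which is multiplied by `n`. The logarithm is
therefore expanded to second order and the quadratic term integrated exactly; the constant `p/(p+2)
tr (H²)` is what cancels the limit. -/
lemma abs_integral_expansionError_le {p n : ℕ} (hp : p ≠ 0) (hn : 1 ≤ n) {E H : Mat p} {K e : ℝ}
    (hsymm : Eᵀ = E) (htr : 2 * E.trace = (E * E).trace - E.trace ^ 2)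
    (hE : √n * entrySum E ≤ K) (hH : entrySum H ≤ K) (hK : K ≤ √n / 2)
    (he : entrySum (√n • E + (2 : ℝ) • H) ≤ e) :
    |n * ∫ w, expansionError n E H w ∂sphUnif p| ≤ 3 * K * e + K ^ 4 / √n + p * K ^ 3 / √n := by
  have := isProbabilityMeasure_sphUnif hp
  have hs : 1 ≤ √n := by rw [Real.one_le_sqrt]; exact_mod_cast hn
  have hs0 : 0 < √n := by linarith
  have hsn : √n * √n = n := Real.mul_self_sqrt (Nat.cast_nonneg n)
  have hE' : entrySum E ≤ K / √n := by rw [le_div_iff₀ hs0]; linarith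
  have hK' : K / √n ≤ 1 / 2 := by rw [div_le_iff₀ hs0]; linarith
  have hK0 : 0 ≤ K := (entrySum_nonneg H).trans hH
  have hn0 : (0 : ℝ) < n := by exact_mod_cast hn
  have hp0 : (0 : ℝ) < p := by exact_mod_cast Nat.pos_of_ne_zero hp
  set r : ℝ := ∫ w, (Real.log (1 + qf E w) - (qf E w - qf E w ^ 2 / 2)) ∂sphUnif p with hr
  have hlogc := continuous_log_one_add_qf (hE'.trans hK')
  have hrb : |r| ≤ 2 * (K / √n) ^ 3 := by
    rw [hr, ← Real.norm_eq_abs]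
    have := norm_integral_le_of_norm_le_const (μ := sphUnif p) (C := 2 * (K / √n) ^ 3)
      (f := fun w => Real.log (1 + qf E w) - (qf E w - qf E w ^ 2 / 2))
      (ae_of_all _ fun w => by
        rw [Real.norm_eq_abs]
        have hx := abs_qf_le E w
        refine (abs_log_one_add_sub_add_le (hx.trans (hE'.trans hK'))).trans ?_
        gcongr
        exact hx.trans hE')
    simpa using this
  have hint : ∫ w, expansionError n E H w ∂sphUnif p =
      -((p : ℝ) / 2) * (r + (E.trace / p - (E.trace ^ 2 + (E * E).trace + (E * E).trace) /
        (p * (p + 2)) / 2)) + p / (p + 2) * (H * H).trace / n := by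
    have h1 : ∫ w, Real.log (1 + qf E w) ∂sphUnif p =
        r + (E.trace / p - (E.trace ^ 2 + (E * E).trace + (E * E).trace) / (p * (p + 2)) / 2) := by
      have h2 := integral_qf_sq hp E
      rw [hsymm] at h2
      rw [hr, ← h2, ← integral_qf hp, ← integral_div, ← integral_sub, ← integral_add]
      · congr 1; ext w; ring
      all_goals exact integrable_sphUnif hp (by fun_prop)
    rw [← h1]
    have h3 : ∫ w, (qf H w - H.trace / p) ∂sphUnif p = 0 := by
      rw [integral_sub, integral_qf hp]
      · simp
      all_goals exact integrable_sphUnif hp (by fun_prop)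
    unfold expansionError
    rw [integral_add, integral_sub, integral_const_mul, integral_const_mul, h3]
    · simp
    all_goals exact integrable_sphUnif hp (by fun_prop)
  have h3 : |E.trace| ≤ (K / √n) ^ 2 :=
    (abs_trace_le_of_det_one htr (by linarith)).trans
      (pow_le_pow_left₀ (entrySum_nonneg E) hE' 2)
  have hdiff : |n * (E * E).trace - 4 * (H * H).trace| ≤ e * (3 * K) := by
    -- A difference of squares under the trace, where the mixed terms cancel; the second factor has
    -- size at most `K + 2K`.
    have h1 : n * (E * E).trace - 4 * (H * H).trace =
        ((√n • E + (2 : ℝ) • H) * (√n • E + (-2 : ℝ) • H)).trace := by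
      simp only [add_mul, mul_add, Matrix.trace_add, Matrix.smul_mul, Matrix.mul_smul,
        Matrix.trace_smul, smul_eq_mul, Matrix.trace_mul_comm H E]
      generalize √(n : ℝ) = s at hsn
      rw [← hsn]; ring
    rw [h1]
    refine (abs_trace_mul_le _ _).trans (mul_le_mul he ?_ (entrySum_nonneg _)
      ((entrySum_nonneg _).trans he))
    refine (entrySum_add_le _ _).trans ?_
    rw [entrySum_smul, entrySum_smul, abs_of_pos hs0, abs_neg, abs_two]
    linarith
  have key : n * ∫ w, expansionError n E H w ∂sphUnif p =
      -(p / (4 * (p + 2))) * (n * (E * E).trace - 4 * (H * H).trace) +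
      (p + 3) / (4 * (p + 2)) * (n * E.trace ^ 2) + -(p / 2) * (n * r) := by
    -- The trace identity replaces only the term linear in `tr E`; its square is already negligible.
    have h5 : E.trace = ((E * E).trace - E.trace ^ 2) / 2 := by linarith
    rw [hint]
    have h6 : (E.trace : ℝ) / p = ((E * E).trace - E.trace ^ 2) / 2 / p := by rw [← h5]
    rw [h6]
    field_simp
    ring
  rw [key]
  have t1 : |-((p : ℝ) / (4 * (p + 2))) * (n * (E * E).trace - 4 * (H * H).trace)| ≤ 3 * K * e := by
    rw [abs_mul, abs_neg, abs_of_nonneg (by positivity : (0 : ℝ) ≤ p / (4 * (p + 2)))]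
    have : (p : ℝ) / (4 * (p + 2)) ≤ 1 := by rw [div_le_one (by positivity)]; linarith
    calc _ ≤ 1 * (e * (3 * K)) := mul_le_mul this hdiff (abs_nonneg _) zero_le_one
      _ = _ := by ring
  have t2 : |((p : ℝ) + 3) / (4 * (p + 2)) * (n * E.trace ^ 2)| ≤ K ^ 4 / √n := by
    rw [abs_mul, abs_of_nonneg (by positivity : (0 : ℝ) ≤ (p + 3) / (4 * (p + 2))),
      abs_of_nonneg (by positivity)]
    have : ((p : ℝ) + 3) / (4 * (p + 2)) ≤ 1 := by rw [div_le_one (by positivity)]; linarith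
    calc _ ≤ 1 * (n * ((K / √n) ^ 2) ^ 2) := by
          refine mul_le_mul this ?_ (by positivity) zero_le_one
          refine mul_le_mul_of_nonneg_left ?_ hn0.le
          rw [← sq_abs E.trace]
          gcongr
      _ = K ^ 4 / n := by
          generalize √(n : ℝ) = s at hsn hs0
          rw [← hsn]; field_simp
      _ ≤ K ^ 4 / √n := by
          gcongr
          nlinarith
  have t3 : |-((p : ℝ) / 2) * (n * r)| ≤ p * K ^ 3 / √n := by
    rw [abs_mul, abs_neg, abs_of_nonneg (by positivity : (0 : ℝ) ≤ p / 2), abs_mul, abs_of_pos hn0]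
    calc _ ≤ (p : ℝ) / 2 * (n * (2 * (K / √n) ^ 3)) := by gcongr
      _ = p * K ^ 3 / √n := by
          generalize √(n : ℝ) = s at hsn hs0
          rw [← hsn]; field_simp
  exact (abs_add_le _ _).trans (add_le_add ((abs_add_le _ _).trans (add_le_add t1 t2)) t3)

lemma isLittleOP_congr {Ω : ℕ → Type*} [∀ n, MeasurableSpace (Ω n)] {P : ∀ n, Measure (Ω n)}
    {X Y : ∀ n, Ω n → ℝ} (h : ∀ᶠ n in atTop, X n =ᵐ[P n] Y n) (hX : IsLittleOP P X) :
    IsLittleOP P Y := by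
  intro ε hε
  refine (hX ε hε).congr' ?_
  filter_upwards [h] with n hn
  refine measure_congr ?_
  filter_upwards [hn] with ω hω
  apply propext
  change ε ≤ |X n ω| ↔ ε ≤ |Y n ω|
  rw [hω]

/-- Quadratic expansion of a product of uniform densities reweighted by `(1 + w' E w)^{-p/2}`, where
`1 + E` has determinant one up to second order and `√n E ≈ -2 H`. -/
theorem isLittleOP_quadratic_expansion {p : ℕ} (hp : p ≠ 0) {E H : ℕ → Mat p}
    (hsymm : ∀ᶠ n in atTop, (E n)ᵀ = E n)
    (htr : ∀ᶠ n in atTop, 2 * (E n).trace = (E n * E n).trace - (E n).trace ^ 2)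
    (hlim : ∀ i j, Tendsto (fun n : ℕ => √n * E n i j + 2 * H n i j) atTop (𝓝 0))
    {C : ℝ} (hH : ∀ᶠ n in atTop, ∀ i j, |H n i j| ≤ C) :
    IsLittleOP (fun n => unifSample p n) fun n w =>
      ∑ i, -((p : ℝ) / 2) * Real.log (1 + qf (E n) (w i)) -
        (p / √n * ∑ i, (qf (H n) (w i) - (H n).trace / p) -
          p / (p + 2) * (H n * H n).trace) := by
  set e : ℕ → ℝ := fun n => entrySum (√n • E n + (2 : ℝ) • H n) with he
  have he0 : Tendsto e atTop (𝓝 0) := tendsto_entrySum_zero fun i j => by simpa using hlim i j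
  set K₀ : ℝ := ∑ _i : Fin p, ∑ _j : Fin p, C
  have hHK : ∀ᶠ n in atTop, entrySum (H n) ≤ K₀ := by
    filter_upwards [hH] with n hn
    exact Finset.sum_le_sum fun i _ => Finset.sum_le_sum fun j _ => hn i j
  -- From `√n E = (√n E + 2H) - 2H`, with the first bracket eventually of size at most 1.
  set K : ℝ := 1 + 2 * K₀
  have hsqrt : Tendsto (fun n : ℕ => √(n : ℝ)) atTop atTop :=
    Real.tendsto_sqrt_atTop.comp tendsto_natCast_atTop_atTop
  have hev : ∀ᶠ n : ℕ in atTop, 1 ≤ n ∧ √n * entrySum (E n) ≤ K ∧ entrySum (H n) ≤ K ∧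
      K ≤ √n / 2 ∧ (E n)ᵀ = E n ∧ 2 * (E n).trace = (E n * E n).trace - (E n).trace ^ 2 := by
    filter_upwards [hsymm, htr, hHK, eventually_ge_atTop 1,
      hsqrt.eventually_ge_atTop (2 * K), he0.eventually_le_const zero_lt_one] with n h1 h2 h3 h4 h5 h6
    have h7 := entrySum_nonneg (H n)
    refine ⟨h4, ?_, by linarith, by linarith, h1, h2⟩
    have h8 : √n • E n = (√n • E n + (2 : ℝ) • H n) + (-2 : ℝ) • H n := by
      rw [add_assoc, ← add_smul]; simp
    have h9 := entrySum_add_le (√n • E n + (2 : ℝ) • H n) ((-2 : ℝ) • H n)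
    rw [← h8, entrySum_smul, entrySum_smul, abs_neg, abs_two,
      abs_of_nonneg (Real.sqrt_nonneg _)] at h9
    have h10 : entrySum (√n • E n + (2 : ℝ) • H n) ≤ 1 := h6
    linarith
  have hinv : Tendsto (fun n : ℕ => (√(n : ℝ))⁻¹) atTop (𝓝 0) := tendsto_inv_atTop_zero.comp hsqrt
  have hcont : ∀ᶠ n in atTop, Continuous (expansionError n (E n) (H n)) := by
    filter_upwards [hev] with n ⟨h1, h2, h3, h4, h5, h6⟩
    refine continuous_expansionError n ?_
    have hs0 : 0 < √(n : ℝ) := Real.sqrt_pos.2 (by exact_mod_cast h1)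
    by_contra! h
    nlinarith
  have hb : ∀ᶠ n : ℕ in atTop, ∀ w, |expansionError n (E n) (H n) w| ≤
      ((p / 2 + 1) * e n + (p + 2) * K ^ 2 / √n) / √n := by
    filter_upwards [hev] with n ⟨h1, h2, h3, h4, h5, h6⟩ w
    have hs0 : 0 < √(n : ℝ) := Real.sqrt_pos.2 (by exact_mod_cast h1)
    rw [le_div_iff₀ hs0, mul_comm]
    exact abs_expansionError_le h1 h6 h2 h3 h4 le_rfl w
  have hlim1 : Tendsto (fun n : ℕ => √n * (((p / 2 + 1) * e n + (p + 2) * K ^ 2 / √n) / √n))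
      atTop (𝓝 0) := by
    have h1 : Tendsto (fun n : ℕ => ((p : ℝ) / 2 + 1) * e n + (p + 2) * K ^ 2 * (√n)⁻¹)
        atTop (𝓝 0) := by
      simpa using (he0.const_mul ((p : ℝ) / 2 + 1)).add (hinv.const_mul ((p + 2) * K ^ 2))
    refine h1.congr' ?_
    filter_upwards [eventually_ge_atTop 1] with n hn
    have hs0 : 0 < √(n : ℝ) := Real.sqrt_pos.2 (by exact_mod_cast hn)
    field_simp
  have hmean : Tendsto (fun n : ℕ => (n : ℝ) * ∫ w, expansionError n (E n) (H n) w ∂sphUnif p)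
      atTop (𝓝 0) := by
    have h1 : Tendsto (fun n : ℕ => 3 * K * e n + K ^ 4 * (√n)⁻¹ + p * K ^ 3 * (√n)⁻¹)
        atTop (𝓝 0) := by
      simpa using ((he0.const_mul (3 * K)).add (hinv.const_mul (K ^ 4))).add
        (hinv.const_mul (p * K ^ 3))
    refine squeeze_zero_norm' ?_ h1
    filter_upwards [hev] with n ⟨h1, h2, h3, h4, h5, h6⟩
    rw [Real.norm_eq_abs]
    exact abs_integral_expansionError_le hp h1 h5 h6 h2 h3 h4 le_rfl
  refine isLittleOP_congr ?_ (isLittleOP_sum_of_small hp hcont hb hlim1 hmean)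
  filter_upwards [eventually_ge_atTop 1] with n hn
  refine ae_of_all _ fun w => ?_
  have hn0 : (n : ℝ) ≠ 0 := by positivity
  simp only [expansionError, Finset.sum_add_distrib, Finset.sum_sub_distrib, ← Finset.mul_sum,
    Finset.sum_const, Finset.card_univ, Fintype.card_fin, nsmul_eq_mul]
  field_simp
  ring

/-! ### Whitening an angular Gaussian sample -/

/-- `R` is the symmetric positive definite square root of `V`. -/
structure IsSqrt {p : ℕ} (R V : Mat p) : Prop where
  symm : Rᵀ = R
  mul_self : R * R = V
  det_ne : R.det ≠ 0
  invSqrt_eq : invSqrt V = R⁻¹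

section
open scoped MatrixOrder

lemma isSqrt_of_posDef {p : ℕ} {R V : Mat p} (hR : R.PosDef) (h : R * R = V) : IsSqrt R V where
  symm := by simpa using hR.isHermitian.eq
  mul_self := h
  det_ne := hR.det_pos.ne'
  invSqrt_eq := by rw [invSqrt, CFC.sqrt_unique h hR.posSemidef.nonneg]

end

namespace IsSqrt

variable {p : ℕ} {R V : Mat p}

lemma inv_det_ne (h : IsSqrt R V) : R⁻¹.det ≠ 0 := by
  rw [Matrix.det_nonsing_inv, Ring.inverse_eq_inv']; exact inv_ne_zero h.det_ne

lemma mul_inv (h : IsSqrt R V) : R * R⁻¹ = 1 :=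
  Matrix.mul_nonsing_inv _ (isUnit_iff_ne_zero.2 h.det_ne)

lemma inv_mul (h : IsSqrt R V) : R⁻¹ * R = 1 :=
  Matrix.nonsing_inv_mul _ (isUnit_iff_ne_zero.2 h.det_ne)

lemma inv_symm (h : IsSqrt R V) : R⁻¹ᵀ = R⁻¹ := by
  rw [Matrix.transpose_nonsing_inv, h.symm]

lemma bilin_inv (h : IsSqrt R V) (u : Vec p) : bilin u V⁻¹ u = ‖act R⁻¹ u‖ ^ 2 := by
  rw [bilin_eq_inner, ← h.mul_self, Matrix.mul_inv_rev, ← act_act]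
  conv_lhs => rw [← h.inv_symm]
  rw [← inner_act_left, h.inv_symm, real_inner_self_eq_norm_sq]

lemma norm_act_inv_pos (h : IsSqrt R V) (u : Sph p) : 0 < ‖act R⁻¹ (u : Vec p)‖ :=
  norm_pos_iff.2 (act_ne_zero h.inv_det_ne (sph_ne_zero u))

lemma bilin_inv_pos (h : IsSqrt R V) (u : Sph p) : 0 < bilin (u : Vec p) V⁻¹ (u : Vec p) := by
  rw [h.bilin_inv]
  exact pow_pos (h.norm_act_inv_pos u) 2

lemma det_pos (h : IsSqrt R V) : 0 < V.det := by
  rw [← h.mul_self, Matrix.det_mul]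
  exact mul_self_pos.2 h.det_ne

lemma map_angularGaussian (h : IsSqrt R V) (hp : p ≠ 0) :
    (angularGaussian V).map (sphMap R⁻¹) = sphUnif p :=
  map_sphMap_angularGaussian hp h.det_ne (by rw [h.symm, h.mul_self])

lemma isProbabilityMeasure (h : IsSqrt R V) (hp : p ≠ 0) :
    IsProbabilityMeasure (angularGaussian V) := by
  have := isProbabilityMeasure_sphUnif hp
  constructor
  have h1 : (sphUnif p) Set.univ = 1 := measure_univ
  rwa [← h.map_angularGaussian hp, Measure.map_apply (measurable_sphMap h.inv_det_ne) .univ,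
    Set.preimage_univ] at h1

lemma measurePreserving (h : IsSqrt R V) (hp : p ≠ 0) (n : ℕ) :
    MeasurePreserving (fun (U : Fin n → Sph p) i => sphMap R⁻¹ (U i)) (sampleLaw n V)
      (unifSample p n) := by
  have h0 := h.isProbabilityMeasure hp
  have h1 := isProbabilityMeasure_sphUnif hp
  have hm := measurable_sphMap h.inv_det_ne
  exact measurePreserving_pi _ _ fun _ => ⟨hm, h.map_angularGaussian hp⟩

/-- The normalized vectors `V^{-1/2} Uᵢ` are the whitened directions, so the statistic depends on
the sample only through a uniform one. -/
lemma scatter_eq (h : IsSqrt R V) {n : ℕ} (U : Fin n → Sph p) :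
    scatter V U = (1 / (n : ℝ)) • ∑ i, outer (sphMap R⁻¹ (U i) : Vec p) (sphMap R⁻¹ (U i)) := by
  rw [scatter, h.invSqrt_eq]
  congr 1
  refine Finset.sum_congr rfl fun i _ => ?_
  rw [coe_sphMap h.inv_det_ne]
  have h1 : outer (act R⁻¹ (U i : Vec p)) (act R⁻¹ (U i : Vec p)) =
      R⁻¹ * outer (U i : Vec p) (U i : Vec p) * R⁻¹ := by
    rw [outer, outer, Matrix.mul_vecMulVec, Matrix.vecMulVec_mul]
    simp only [act]
    rw [← Matrix.vecMul_transpose, h.inv_symm]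
  have h2 : ∀ (c : ℝ) (x : Vec p), outer (c • x) (c • x) = (c ^ 2) • outer x x := by
    intro c x; ext i j; simp [outer, Matrix.vecMulVec_apply]; ring
  rw [h2, h1, inv_pow, one_div]

end IsSqrt

lemma upsilon_eq {p n : ℕ} (hn : n ≠ 0) {R V : Mat p} (h : IsSqrt R V) (U : Fin n → Sph p) :
    upsilon V U = (√n)⁻¹ • ∑ i, (p : ℝ) • (outer (sphMap R⁻¹ (U i) : Vec p) (sphMap R⁻¹ (U i)) -
      (1 / (p : ℝ)) • (1 : Mat p)) := by
  have hs : √(n : ℝ) ≠ 0 := (Real.sqrt_pos.2 (by positivity)).ne'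
  have hsn : √n * √n = (n : ℝ) := Real.mul_self_sqrt (Nat.cast_nonneg n)
  rw [upsilon, centeredScatter, h.scatter_eq, ← Finset.smul_sum, Finset.sum_sub_distrib,
    Finset.sum_const, Finset.card_univ, Fintype.card_fin, smul_sub, smul_sub, smul_sub, smul_sub]
  have h1 : √(n : ℝ) * (1 / n) = (√n)⁻¹ := by
    generalize √(n : ℝ) = s at hs hsn
    rw [← hsn]; field_simp
  have h2 : (√(n : ℝ))⁻¹ * n = √n := by
    generalize √(n : ℝ) = s at hs hsn
    rw [← hsn]; field_simp
  congr 1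
  · rw [smul_smul (√(n : ℝ)), h1, smul_comm]
  · rw [← Nat.cast_smul_eq_nsmul ℝ, smul_comm (√(n : ℝ))⁻¹ (p : ℝ), smul_smul (√(n : ℝ))⁻¹, h2]

lemma trace_mul_outer_self {p : ℕ} (H : Mat p) (w : Sph p) :
    (H * outer (w : Vec p) w).trace = qf H w := by
  rw [outer, Matrix.mul_vecMulVec, Matrix.trace_vecMulVec, qf, bilin, dotProduct_comm]

lemma trace_mul_upsilon {p n : ℕ} (hp : p ≠ 0) (hn : n ≠ 0) {R V : Mat p} (h : IsSqrt R V)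
    (H : Mat p) (U : Fin n → Sph p) :
    (H * upsilon V U).trace =
      p / √n * ∑ i, (qf H (sphMap R⁻¹ (U i)) - H.trace / p) := by
  have hp' : (p : ℝ) ≠ 0 := by exact_mod_cast hp
  rw [upsilon_eq hn h, ← Finset.smul_sum, Matrix.mul_smul, Matrix.mul_smul, Matrix.mul_sum,
    Matrix.trace_smul, Matrix.trace_smul, Matrix.trace_sum, smul_eq_mul, smul_eq_mul]
  simp only [mul_sub, Matrix.trace_sub, trace_mul_outer_self, Matrix.mul_smul, Matrix.trace_smul,
    mul_one, smul_eq_mul]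
  rw [← mul_assoc]
  congr 1
  · ring
  · exact Finset.sum_congr rfl fun i _ => by ring

/-! ### The log-likelihood ratio -/

/-- On a rectangle the restricted density is a product of functions of independent coordinates, so
its integral factorizes. -/
lemma pi_withDensity_prod {ι Ω : Type*} [Fintype ι] [MeasurableSpace Ω] {μ : Measure Ω}
    [IsProbabilityMeasure μ] {ρ : Ω → ENNReal} (hρ : Measurable ρ)
    [SigmaFinite (μ.withDensity ρ)] :
    Measure.pi (fun _ : ι => μ.withDensity ρ) =
      (Measure.pi fun _ : ι => μ).withDensity fun x => ∏ i, ρ (x i) := by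
  refine Measure.pi_eq fun s hs => ?_
  rw [withDensity_apply _ (MeasurableSet.univ_pi hs), ← lintegral_indicator (.univ_pi hs)]
  have h1 : ∀ x : ι → Ω, (Set.univ.pi s).indicator (fun x => ∏ i, ρ (x i)) x =
      ∏ i, (s i).indicator ρ (x i) := by
    intro x
    by_cases hx : x ∈ Set.univ.pi s
    · rw [Set.indicator_of_mem hx]
      exact Finset.prod_congr rfl fun i _ => (Set.indicator_of_mem (hx i trivial) _).symm
    · rw [Set.indicator_of_notMem hx]
      simp only [Set.mem_pi, Set.mem_univ, true_implies, not_forall] at hx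
      obtain ⟨i, hi⟩ := hx
      exact (Finset.prod_eq_zero (Finset.mem_univ i) (Set.indicator_of_notMem hi _)).symm
  simp_rw [h1]
  have hm : ∀ i, Measurable ((s i).indicator ρ) := fun i => hρ.indicator (hs i)
  have hind := iIndepFun_pi (μ := fun _ : ι => μ) (X := fun i => (s i).indicator ρ)
    fun i => (hm i).aemeasurable
  rw [lintegral_prod_eq_prod_lintegral_of_indepFun _ _ hind
    fun i => (hm i).comp (measurable_pi_apply i)]
  refine Finset.prod_congr rfl fun i _ => ?_
  have h2 := (measurePreserving_eval (fun _ : ι => μ) i).lintegral_comp (hm i)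
  rw [withDensity_apply _ (hs i), ← lintegral_indicator (hs i), ← h2]

lemma measurable_bilin_self {p : ℕ} (A : Mat p) :
    Measurable fun u : Sph p => bilin (u : Vec p) A (u : Vec p) :=
  (continuous_qf A).measurable

/-- With `w = R⁻¹u / ‖R⁻¹u‖`, the outer factors `R` cancel and the squared norm in the denominator
is `u' V₀⁻¹ u`. -/
lemma one_add_qf_sphMap {p : ℕ} {R V₀ V₁ E : Mat p} (h₀ : IsSqrt R V₀)
    (hE : R * V₁⁻¹ * R = 1 + E) (u : Sph p) :
    1 + qf E (sphMap R⁻¹ u) =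
      bilin (u : Vec p) V₁⁻¹ (u : Vec p) / bilin (u : Vec p) V₀⁻¹ (u : Vec p) := by
  have h1 : 1 + qf E (sphMap R⁻¹ u) = qf (R * V₁⁻¹ * R) (sphMap R⁻¹ u) := by
    rw [hE, qf_add]
    congr 1
    rw [qf, bilin_eq_inner, act_one, real_inner_self_eq_norm_sq, norm_sph, one_pow]
  have hu := h₀.norm_act_inv_pos u
  rw [h1, qf, h₀.bilin_inv, coe_sphMap h₀.inv_det_ne, bilin_eq_inner, bilin_eq_inner, act_smul,
    real_inner_smul_left, real_inner_smul_right, act_act, mul_assoc, h₀.mul_inv, mul_one,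
    ← act_act, inner_act_left, h₀.inv_symm, act_act, act_act, ← mul_assoc, h₀.inv_mul, one_mul]
  field_simp

/-- The determinants agree, so the normalizing constants cancel and each observation contributes `(1
+ w' E w)^(-p/2)`. The identity holds only almost everywhere, as a Radon–Nikodym derivative does. -/
lemma logLik_ae_eq {p : ℕ} (hp : p ≠ 0) (n : ℕ) {R R₁ V₀ V₁ E : Mat p} (h₀ : IsSqrt R V₀)
    (h₁ : IsSqrt R₁ V₁) (hdet : V₀.det = V₁.det) (hE : R * V₁⁻¹ * R = 1 + E) :
    logLik n V₀ V₁ =ᵐ[sampleLaw n V₀] fun U =>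
      ∑ i, -((p : ℝ) / 2) * Real.log (1 + qf E (sphMap R⁻¹ (U i))) := by
  have hP₀ := h₀.isProbabilityMeasure hp
  have hP₁ := h₁.isProbabilityMeasure hp
  have hp' : (0 : ℝ) < p := by exact_mod_cast Nat.pos_of_ne_zero hp
  have hpos : ∀ u : Sph p, 0 < 1 + qf E (sphMap R⁻¹ u) := fun u => by
    rw [one_add_qf_sphMap h₀ hE]
    exact div_pos (h₁.bilin_inv_pos u) (h₀.bilin_inv_pos u)
  set ρ : Sph p → ENNReal := fun u =>
    ENNReal.ofReal ((1 + qf E (sphMap R⁻¹ u)) ^ (-((p : ℝ) / 2))) with hρ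
  have hρm : Measurable ρ := by
    refine Measurable.ennreal_ofReal (Measurable.pow_const ?_ _)
    exact ((continuous_qf E).measurable.comp (measurable_sphMap h₀.inv_det_ne)).const_add 1
  have hdens : angularGaussian V₁ = (angularGaussian V₀).withDensity ρ := by
    have hm0 : Measurable fun u : Sph p =>
        ENNReal.ofReal (angularGaussianDensity V₀ (u : Vec p)) :=
      (((measurable_bilin_self V₀⁻¹).pow_const _).const_mul _).ennreal_ofReal
    rw [angularGaussian, angularGaussian, ← withDensity_mul _ hm0 hρm]
    congr 1
    ext u
    have hq0 := h₀.bilin_inv_pos u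
    have hq1 := h₁.bilin_inv_pos u
    have hG : 0 < Real.Gamma ((p : ℝ) / 2) := Real.Gamma_pos_of_pos (by positivity)
    have hD := Real.sqrt_pos.2 h₀.det_pos
    simp only [Pi.mul_apply, hρ]
    rw [← ENNReal.ofReal_mul]
    · congr 1
      rw [angularGaussianDensity, angularGaussianDensity, one_add_qf_sphMap h₀ hE, hdet,
        Real.div_rpow hq1.le hq0.le]
      have := Real.rpow_pos_of_pos hq0 (-((p : ℝ) / 2))
      field_simp
    · rw [angularGaussianDensity]
      positivity
  have hsf : SigmaFinite ((angularGaussian V₀).withDensity ρ) := by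
    rw [← hdens]; infer_instance
  have hpi : sampleLaw n V₁ = (sampleLaw n V₀).withDensity fun U => ∏ i, ρ (U i) := by
    rw [sampleLaw, sampleLaw, hdens]
    exact pi_withDensity_prod hρm
  have hsf0 : SigmaFinite (sampleLaw n V₀) := by rw [sampleLaw]; infer_instance
  have hrn := Measure.rnDeriv_withDensity (sampleLaw n V₀)
    (f := fun U : Fin n → Sph p => ∏ i, ρ (U i))
    (Finset.measurable_prod _ fun i _ => hρm.comp (measurable_pi_apply i))
  rw [logLik, llr_def, hpi]
  filter_upwards [hrn] with U hU
  rw [hU, ENNReal.toReal_prod, Real.log_prod]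
  · refine Finset.sum_congr rfl fun i _ => ?_
    simp only [hρ]
    rw [ENNReal.toReal_ofReal (Real.rpow_nonneg (hpos _).le _), Real.log_rpow (hpos _)]
  · intro i _
    simp only [hρ]
    rw [ENNReal.toReal_ofReal (Real.rpow_nonneg (hpos _).le _)]
    exact (Real.rpow_pos_of_pos (hpos _) _).ne'

/-! ### Transfer of stochastic convergence -/

lemma isLittleOP_of_measurePreserving {Ω Ω' : ℕ → Type*} [∀ n, MeasurableSpace (Ω n)]
    [∀ n, MeasurableSpace (Ω' n)] {P : ∀ n, Measure (Ω n)} {Q : ∀ n, Measure (Ω' n)}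
    {g : ∀ n, Ω n → Ω' n} (hg : ∀ᶠ n in atTop, MeasurePreserving (g n) (P n) (Q n))
    {X : ∀ n, Ω' n → ℝ} (hXm : ∀ᶠ n in atTop, Measurable (X n)) (hX : IsLittleOP Q X) :
    IsLittleOP P fun n ω => X n (g n ω) := by
  intro ε hε
  refine (hX ε hε).congr' ?_
  filter_upwards [hg, hXm] with n hn hm
  have hs : MeasurableSet {ω | ε ≤ |X n ω|} :=
    measurableSet_le measurable_const (continuous_abs.measurable.comp hm)
  exact (hn.measure_preimage hs.nullMeasurableSet).symm

/-- Quadratic expansion of the log-likelihood ratio of two angular Gaussian samples. -/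
theorem isLittleOP_logLik_sub {p : ℕ} (hp : p ≠ 0) {R R₁ V₀ V₁ E H : ℕ → Mat p}
    (h₀ : ∀ n, 1 ≤ n → IsSqrt (R n) (V₀ n)) (h₁ : ∀ n, 1 ≤ n → IsSqrt (R₁ n) (V₁ n))
    (hdet : ∀ n, 1 ≤ n → (V₀ n).det = (V₁ n).det)
    (hE : ∀ n, 1 ≤ n → R n * (V₁ n)⁻¹ * R n = 1 + E n)
    (hsymm : ∀ n, 1 ≤ n → (E n)ᵀ = E n)
    (htr : ∀ n, 1 ≤ n → 2 * (E n).trace = (E n * E n).trace - (E n).trace ^ 2)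
    (hlim : ∀ i j, Tendsto (fun n : ℕ => √n * E n i j + 2 * H n i j) atTop (𝓝 0))
    {C : ℝ} (hH : ∀ n, 1 ≤ n → ∀ i j, |H n i j| ≤ C) :
    IsLittleOP (fun n => sampleLaw n (V₀ n)) fun n U =>
      logLik n (V₀ n) (V₁ n) U -
        ((H n * upsilon (V₀ n) U).trace - p / (p + 2) * (H n * H n).trace) := by
  have hev : ∀ᶠ n : ℕ in atTop, 1 ≤ n := eventually_ge_atTop 1
  have hcore := isLittleOP_quadratic_expansion hp (hev.mono hsymm) (hev.mono htr) hlim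
    (hev.mono hH)
  have hmeas : ∀ n : ℕ, Measurable fun w : Fin n → Sph p =>
      ∑ i, -((p : ℝ) / 2) * Real.log (1 + qf (E n) (w i)) -
        (p / √n * ∑ i, (qf (H n) (w i) - (H n).trace / p) -
          p / (p + 2) * (H n * H n).trace) := by
    intro n
    have hqm : ∀ (A : Mat p) (i : Fin n), Measurable fun w : Fin n → Sph p => qf A (w i) :=
      fun A i => (continuous_qf A).measurable.comp (measurable_pi_apply i)
    refine Measurable.sub (Finset.measurable_sum _ fun i _ => ?_)
      (((Finset.measurable_sum _ fun i _ => (hqm _ i).sub_const _).const_mul _).sub_const _)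
    exact (Real.measurable_log.comp ((hqm _ i).const_add 1)).const_mul _
  have htrans := isLittleOP_of_measurePreserving (P := fun n => sampleLaw n (V₀ n))
    (g := fun n U i => sphMap (R n)⁻¹ (U i))
    (hev.mono fun n hn => (h₀ n hn).measurePreserving hp n) (Eventually.of_forall hmeas) hcore
  refine isLittleOP_congr ?_ htrans
  filter_upwards [hev] with n hn
  filter_upwards [logLik_ae_eq hp n (h₀ n hn) (h₁ n hn) (hdet n hn) (hE n hn)] with U hU
  rw [hU, trace_mul_upsilon hp (by omega) (h₀ n hn)]

/-- Asymptotic normality of normalized sums over a whitened angular Gaussian sample. -/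
theorem asympNormal_of_whitened_sum {p : ℕ} (hp : p ≠ 0) {R V : ℕ → Mat p}
    (hR : ∀ n, 1 ≤ n → IsSqrt (R n) (V n)) {ι : Type*} [Fintype ι] [DecidableEq ι]
    {h : Sph p → EuclideanSpace ℝ ι} (hh : Continuous h) {C : Matrix ι ι ℝ}
    (hC : C.IsHermitian) (h1 : ∀ t, ∫ w, inner ℝ (h w) t ∂sphUnif p = 0)
    (h2 : ∀ t, ∫ w, (inner ℝ (h w) t) ^ 2 ∂sphUnif p = t.ofLp ⬝ᵥ C *ᵥ t.ofLp)
    {X : ∀ n, (Fin n → Sph p) → EuclideanSpace ℝ ι}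
    (hX : ∀ n, 1 ≤ n → ∀ U, X n U = (√n)⁻¹ • ∑ i, h (sphMap (R n)⁻¹ (U i))) :
    AsympNormal (fun n => sampleLaw n (V n)) X C := by
  have hcont : ∀ n : ℕ, Continuous fun w : Fin n → Sph p => (√n)⁻¹ • ∑ i, h (w i) := fun n => by
    fun_prop
  refine ⟨fun n => ?_, fun f => ?_⟩
  · rcases Nat.eq_zero_or_pos n with rfl | hn
    -- The empty sample lives on a one-point space, so nothing need be known about `X 0`.
    · exact Subsingleton.measurable.aemeasurable
    · have : X n = (fun w : Fin n → Sph p => (√n)⁻¹ • ∑ i, h (w i)) ∘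
        fun (U : Fin n → Sph p) i => sphMap (R n)⁻¹ (U i) := funext fun U => hX n hn U
      rw [this]
      exact ((hcont n).measurable.comp ((hR n hn).measurePreserving hp n).measurable).aemeasurable
  · refine (tendsto_integral_normalized_sum hp hh hC h1 h2 f).congr' ?_
    filter_upwards [eventually_ge_atTop 1] with n hn
    have hmp := (hR n hn).measurePreserving hp n
    have hfc : Continuous fun w : Fin n → Sph p => f ((√n)⁻¹ • ∑ i, h (w i)) :=
      f.continuous.comp (hcont n)
    rw [← hmp.map_eq, integral_map hmp.measurable.aemeasurable hfc.aestronglyMeasurable]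
    simp only [hX n hn]

/-! ### Single-spike matrices -/

lemma outer_mul_outer {p : ℕ} (x y z v : Vec p) :
    outer x y * outer z v = (inner ℝ y z : ℝ) • outer x v := by
  rw [outer, outer, Matrix.vecMulVec_mul_vecMulVec, inner_eq_dotProduct, outer,
    Matrix.vecMulVec_smul]

lemma trace_outer {p : ℕ} (x y : Vec p) : (outer x y).trace = inner ℝ x y := by
  rw [outer, Matrix.trace_vecMulVec, inner_eq_dotProduct]

lemma act_outer {p : ℕ} (x y z : Vec p) : act (outer x y) z = (inner ℝ y z : ℝ) • x := by
  ext i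
  simp only [act, outer, Matrix.vecMulVec_mulVec, inner_eq_dotProduct, PiLp.smul_apply, smul_eq_mul]
  simp [mul_comm]

lemma transpose_outer {p : ℕ} (x y : Vec p) : (outer x y)ᵀ = outer y x := by
  ext i j; simp [outer, Matrix.vecMulVec_apply, mul_comm]

lemma mul_outer_mul {p : ℕ} (A B : Mat p) (x y : Vec p) :
    A * outer x y * B = outer (act A x) (act Bᵀ y) := by
  rw [outer, outer, Matrix.mul_vecMulVec, Matrix.vecMulVec_mul]
  simp only [act]
  rw [Matrix.mulVec_transpose]

lemma act_add_left {p : ℕ} (A B : Mat p) (x : Vec p) : act (A + B) x = act A x + act B x := by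
  ext i; simp [act, Matrix.add_mulVec]

lemma act_smul_left {p : ℕ} (c : ℝ) (A : Mat p) (x : Vec p) : act (c • A) x = c • act A x := by
  ext i; simp [act, Matrix.smul_mulVec]

/-- The matrix `a I + b θ θ'`. -/
def spike {p : ℕ} (a b : ℝ) (θ : Vec p) : Mat p := a • (1 : Mat p) + b • outer θ θ

lemma transpose_spike {p : ℕ} (a b : ℝ) (θ : Vec p) : (spike a b θ)ᵀ = spike a b θ := by
  simp [spike, transpose_outer]

lemma act_spike {p : ℕ} (a b : ℝ) (θ x : Vec p) :
    act (spike a b θ) x = a • x + (b * inner ℝ θ x) • θ := by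
  rw [spike, act_add_left, act_smul_left, act_smul_left, act_one, act_outer, smul_smul]

lemma spike_mul_spike {p : ℕ} (a b c d : ℝ) {θ : Vec p} (hθ : ‖θ‖ = 1) :
    spike a b θ * spike c d θ = spike (a * c) (a * d + b * c + b * d) θ := by
  simp only [spike, add_mul, mul_add, Matrix.smul_mul, Matrix.mul_smul, one_mul, mul_one,
    outer_mul_outer, real_inner_self_eq_norm_sq, hθ, one_pow, one_smul, smul_smul]
  module

lemma posDef_spike {p : ℕ} {a b : ℝ} (ha : 0 < a) (hb : 0 ≤ b) (θ : Vec p) :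
    (spike a b θ).PosDef := by
  refine Matrix.PosDef.of_dotProduct_mulVec_pos ?_ fun x hx => ?_
  · rw [Matrix.IsHermitian, Matrix.conjTranspose_eq_transpose_of_trivial, transpose_spike]
  · rw [star_trivial]
    set y : Vec p := WithLp.toLp 2 x
    have hy : 0 < ‖y‖ := norm_pos_iff.2 fun h => hx (congrArg WithLp.ofLp h)
    change 0 < bilin y (spike a b θ) y
    rw [bilin_eq_inner, act_spike, inner_add_right, real_inner_smul_right, real_inner_smul_right,
      real_inner_self_eq_norm_sq, real_inner_comm, mul_assoc]
    have := mul_self_nonneg (inner ℝ y θ : ℝ)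
    positivity

lemma inv_spike {p : ℕ} {a b : ℝ} (ha : a ≠ 0) (hab : a + b ≠ 0) {θ : Vec p} (hθ : ‖θ‖ = 1) :
    (spike a b θ)⁻¹ = spike a⁻¹ (-(b / (a * (a + b)))) θ := by
  refine Matrix.inv_eq_right_inv ?_
  rw [spike_mul_spike _ _ _ _ hθ, mul_inv_cancel₀ ha]
  have : a * -(b / (a * (a + b))) + b * a⁻¹ + b * -(b / (a * (a + b))) = 0 := by
    field_simp; ring
  rw [this]
  simp [spike]

/-- The matrix determinant lemma. The value does not depend on the direction, whence the equal
determinants of the two shapes. -/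
lemma det_spike {p : ℕ} {a : ℝ} (ha : a ≠ 0) (b : ℝ) {θ : Vec p} (hθ : ‖θ‖ = 1) :
    (spike a b θ).det = a ^ p * (1 + b / a) := by
  have h1 : spike a b θ = a • (1 + Matrix.replicateCol Unit ((b / a) • θ.ofLp) *
      Matrix.replicateRow Unit θ.ofLp) := by
    rw [← Matrix.vecMulVec_eq, Matrix.smul_vecMulVec, smul_add, smul_smul, mul_div_cancel₀ _ ha]
    rfl
  rw [h1, Matrix.det_smul, Matrix.det_one_add_replicateCol_mul_replicateRow, Fintype.card_fin,
    dotProduct_smul, ← inner_eq_dotProduct, real_inner_self_eq_norm_sq, hθ]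
  simp

/-- The eigenvalues are `a + b` along `θ` and `a` on its orthogonal complement; take their square
roots. -/
lemma isSqrt_spike {p : ℕ} {a b : ℝ} (ha : 0 < a) (hb : 0 ≤ b) {θ : Vec p} (hθ : ‖θ‖ = 1) :
    IsSqrt (spike (√a) (√(a + b) - √a) θ) (spike a b θ) := by
  refine isSqrt_of_posDef (posDef_spike (Real.sqrt_pos.2 ha)
    (sub_nonneg.2 (Real.sqrt_le_sqrt (by linarith))) θ) ?_
  rw [spike_mul_spike _ _ _ _ hθ, Real.mul_self_sqrt ha.le]
  congr 1
  have h1 := Real.mul_self_sqrt ha.le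
  have h2 := Real.mul_self_sqrt (by linarith : 0 ≤ a + b)
  linear_combination h2 - h1

/-- The image of `θ₁` under the square root of the spike matrix in direction `θ₀`. -/
def spikeImage {p : ℕ} (a b : ℝ) (θ₀ θ₁ : Vec p) : Vec p :=
  √a • θ₁ + ((√(a + b) - √a) * inner ℝ θ₀ θ₁) • θ₀

/-- `V₀^{1/2} V₁⁻¹ V₀^{1/2} - I` for the spike matrices `V₀`, `V₁` in directions `θ₀`, `θ₁`. -/
def spikeDiff {p : ℕ} (a b : ℝ) (θ₀ θ₁ : Vec p) : Mat p :=
  (b / (a * (a + b))) • (outer (spikeImage a b θ₀ θ₀) (spikeImage a b θ₀ θ₀) -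
    outer (spikeImage a b θ₀ θ₁) (spikeImage a b θ₀ θ₁))

lemma spikeImage_eq_act {p : ℕ} (a b : ℝ) (θ₀ θ₁ : Vec p) :
    act (spike (√a) (√(a + b) - √a) θ₀) θ₁ = spikeImage a b θ₀ θ₁ := act_spike ..

lemma spikeImage_self {p : ℕ} (a b : ℝ) {θ : Vec p} (hθ : ‖θ‖ = 1) :
    spikeImage a b θ θ = √(a + b) • θ := by
  rw [spikeImage, real_inner_self_eq_norm_sq, hθ, ← add_smul]
  congr 1; ring

/-- The inverses of the two spikes share their multiple of the identity, so they differ by a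
combination of two rank-one matrices, which `R` then maps to rank-one matrices. -/
lemma sqrt_mul_inv_mul_sqrt_spike {p : ℕ} {a b : ℝ} (ha : 0 < a) (hb : 0 ≤ b) {θ₀ θ₁ : Vec p}
    (h₀ : ‖θ₀‖ = 1) (h₁ : ‖θ₁‖ = 1) :
    spike (√a) (√(a + b) - √a) θ₀ * (spike a b θ₁)⁻¹ * spike (√a) (√(a + b) - √a) θ₀ =
      1 + spikeDiff a b θ₀ θ₁ := by
  have hs := isSqrt_spike ha hb h₀
  set R := spike (√a) (√(a + b) - √a) θ₀ with hR
  have h1 : (spike a b θ₁)⁻¹ = (spike a b θ₀)⁻¹ +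
      (b / (a * (a + b))) • (outer θ₀ θ₀ - outer θ₁ θ₁) := by
    rw [inv_spike ha.ne' (by linarith) h₀, inv_spike ha.ne' (by linarith) h₁, spike, spike]
    module
  have h2 : R * (spike a b θ₀)⁻¹ * R = 1 := by
    rw [← hs.mul_self, Matrix.mul_inv_rev, ← mul_assoc, hs.mul_inv, one_mul, hs.inv_mul]
  rw [h1, mul_add, add_mul, h2, Matrix.mul_smul, Matrix.smul_mul, Matrix.mul_sub, Matrix.sub_mul,
    mul_outer_mul, mul_outer_mul, hs.symm, hR, spikeImage_eq_act, spikeImage_eq_act, spikeDiff]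

lemma transpose_spikeDiff {p : ℕ} (a b : ℝ) (θ₀ θ₁ : Vec p) :
    (spikeDiff a b θ₀ θ₁)ᵀ = spikeDiff a b θ₀ θ₁ := by
  simp [spikeDiff, transpose_outer]

/-- For a matrix `E` of rank at most two, `det (1 + E) = 1 + tr E + ((tr E)² - tr (E²)) / 2`, and
here the determinant is 1. The check goes through the Gram matrix of the two images. -/
lemma two_mul_trace_spikeDiff {p : ℕ} {a b : ℝ} (ha : 0 < a) (hb : 0 ≤ b) {θ₀ θ₁ : Vec p}
    (h₀ : ‖θ₀‖ = 1) (h₁ : ‖θ₁‖ = 1) :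
    2 * (spikeDiff a b θ₀ θ₁).trace =
      (spikeDiff a b θ₀ θ₁ * spikeDiff a b θ₀ θ₁).trace - (spikeDiff a b θ₀ θ₁).trace ^ 2 := by
  have h2 := Real.mul_self_sqrt (by linarith : 0 ≤ a + b)
  have h3 := Real.mul_self_sqrt ha.le
  set g : ℝ := inner ℝ θ₀ θ₁ with hg
  have hα : (inner ℝ (spikeImage a b θ₀ θ₀) (spikeImage a b θ₀ θ₀) : ℝ) = a + b := by
    rw [spikeImage_self _ _ h₀, real_inner_smul_left, real_inner_smul_right,
      real_inner_self_eq_norm_sq, h₀]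
    linarith
  have hβ : (inner ℝ (spikeImage a b θ₀ θ₁) (spikeImage a b θ₀ θ₁) : ℝ) = a + b * g ^ 2 := by
    have hg' : (inner ℝ θ₁ θ₀ : ℝ) = g := by rw [hg, real_inner_comm]
    have hs₀ : (inner ℝ θ₀ θ₀ : ℝ) = 1 := by rw [real_inner_self_eq_norm_sq, h₀, one_pow]
    have hs₁ : (inner ℝ θ₁ θ₁ : ℝ) = 1 := by rw [real_inner_self_eq_norm_sq, h₁, one_pow]
    simp only [spikeImage, inner_add_left, inner_add_right, real_inner_smul_left,
      real_inner_smul_right, hs₀, hs₁, hg', ← hg]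
    linear_combination (1 - g ^ 2) * h3 + g ^ 2 * h2
  have hc : (inner ℝ (spikeImage a b θ₀ θ₀) (spikeImage a b θ₀ θ₁) : ℝ) = (a + b) * g := by
    rw [spikeImage_self _ _ h₀]
    simp only [spikeImage, inner_add_right, real_inner_smul_left, real_inner_smul_right,
      real_inner_self_eq_norm_sq, h₀, ← hg]
    linear_combination g * h2
  have hc' : (inner ℝ (spikeImage a b θ₀ θ₁) (spikeImage a b θ₀ θ₀) : ℝ) = (a + b) * g := by
    rw [real_inner_comm, hc]
  simp only [spikeDiff, Matrix.trace_smul, Matrix.trace_sub, trace_outer, Matrix.smul_mul,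
    Matrix.mul_smul, Matrix.mul_sub, Matrix.sub_mul, outer_mul_outer, hα, hβ, hc, hc', smul_eq_mul]
  have hab : a + b ≠ 0 := by positivity
  field_simp
  ring

/-- Quadratic expansion of the log-likelihood ratio between single-spike models. -/
theorem isLittleOP_logLik_spike_sub {p : ℕ} (hp : p ≠ 0) {a b : ℕ → ℝ}
    (ha : ∀ n, 1 ≤ n → 0 < a n) (hb : ∀ n, 1 ≤ n → 0 ≤ b n) {θ₀ : Vec p} (h₀ : ‖θ₀‖ = 1)
    {θ₁ : ℕ → Vec p} (h₁ : ∀ n, 1 ≤ n → ‖θ₁ n‖ = 1) {V₀ V₁ H : ℕ → Mat p}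
    (hV₀ : ∀ n, 1 ≤ n → V₀ n = spike (a n) (b n) θ₀)
    (hV₁ : ∀ n, 1 ≤ n → V₁ n = spike (a n) (b n) (θ₁ n))
    (hlim : ∀ i j, Tendsto (fun n : ℕ => √n * spikeDiff (a n) (b n) θ₀ (θ₁ n) i j + 2 * H n i j)
      atTop (𝓝 0))
    {C : ℝ} (hH : ∀ n, 1 ≤ n → ∀ i j, |H n i j| ≤ C) :
    IsLittleOP (fun n => sampleLaw n (V₀ n)) fun n U =>
      logLik n (V₀ n) (V₁ n) U -
        ((H n * upsilon (V₀ n) U).trace - p / (p + 2) * (H n * H n).trace) := by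
  refine isLittleOP_logLik_sub hp
    (R := fun n => spike (√(a n)) (√(a n + b n) - √(a n)) θ₀)
    (R₁ := fun n => spike (√(a n)) (√(a n + b n) - √(a n)) (θ₁ n))
    (E := fun n => spikeDiff (a n) (b n) θ₀ (θ₁ n))
    (fun n hn => ?_) (fun n hn => ?_) (fun n hn => ?_) (fun n hn => ?_)
    (fun n hn => transpose_spikeDiff _ _ _ _)
    (fun n hn => two_mul_trace_spikeDiff (ha n hn) (hb n hn) h₀ (h₁ n hn)) hlim hH
  · rw [hV₀ n hn]; exact isSqrt_spike (ha n hn) (hb n hn) h₀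
  · rw [hV₁ n hn]; exact isSqrt_spike (ha n hn) (hb n hn) (h₁ n hn)
  · rw [hV₀ n hn, hV₁ n hn, det_spike (ha n hn).ne' _ h₀, det_spike (ha n hn).ne' _ (h₁ n hn)]
  · rw [hV₁ n hn]; exact sqrt_mul_inv_mul_sqrt_spike (ha n hn) (hb n hn) h₀ (h₁ n hn)

/-! ### Parameters of the single-spike model -/

/-- In dimension at least two, projecting a suitable basis vector off `θ` gives a nonzero vector on
which the quadratic form is `a ‖x‖²`. -/
lemma pos_of_posDef_spike {p : ℕ} (hp : 2 ≤ p) {a b : ℝ} {θ : Vec p} (hθ : ‖θ‖ = 1)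
    (h : (spike a b θ).PosDef) : 0 < a := by
  have hsum : ∑ i, θ i ^ 2 = 1 := sum_sq_sph ⟨θ, by simpa using hθ⟩
  obtain ⟨i, hi⟩ : ∃ i, θ i ^ 2 < 1 := by
    by_contra! hcon
    have : ∑ _i : Fin p, (1 : ℝ) ≤ ∑ i, θ i ^ 2 := Finset.sum_le_sum fun i _ => hcon i
    rw [hsum] at this
    simp only [Finset.sum_const, Finset.card_univ, Fintype.card_fin, nsmul_eq_mul, mul_one] at this
    have hp' : (2 : ℝ) ≤ p := by exact_mod_cast hp
    linarith
  set x : Vec p := EuclideanSpace.single i 1 - θ i • θ with hx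
  have hθx : (inner ℝ θ x : ℝ) = 0 := by
    rw [hx, inner_sub_right, real_inner_smul_right, real_inner_self_eq_norm_sq, hθ,
      inner_single_one]
    ring
  have hxx : (inner ℝ x x : ℝ) = 1 - θ i ^ 2 := by
    conv_lhs => rw [hx]
    rw [inner_sub_left, real_inner_smul_left, ← hx, hθx, hx, inner_sub_right,
      real_inner_smul_right, inner_single_single, real_inner_comm, inner_single_one]
    simp [sq]
  have hx0 : x.ofLp ≠ 0 := by
    intro h0
    have : x = 0 := by ext j; simpa using congrFun h0 j
    rw [this, inner_zero_left] at hxx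
    linarith
  have hpos := h.dotProduct_mulVec_pos hx0
  rw [star_trivial] at hpos
  change 0 < bilin x (spike a b θ) x at hpos
  rw [bilin_eq_inner, act_spike, hθx, mul_zero, zero_smul, add_zero, real_inner_smul_right,
    hxx] at hpos
  exact pos_of_mul_pos_left hpos (by linarith)

lemma eq_inner_smul_of_dim_one {θ : Vec 1} (hθ : ‖θ‖ = 1) (x : Vec 1) :
    x = (inner ℝ θ x : ℝ) • θ := by
  have h : θ 0 ^ 2 = 1 := by simpa using sum_sq_sph ⟨θ, by simpa using hθ⟩
  have hx : (inner ℝ θ x : ℝ) = θ 0 * x 0 := by rw [inner_eq_dotProduct]; simp [dotProduct]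
  ext i
  rw [Subsingleton.elim i 0, PiLp.smul_apply, hx, smul_eq_mul]
  linear_combination (-x 0) * h

lemma outer_self_of_dim_one {θ : Vec 1} (hθ : ‖θ‖ = 1) : outer θ θ = 1 := by
  have h : θ 0 ^ 2 = 1 := by simpa using sum_sq_sph ⟨θ, by simpa using hθ⟩
  ext i j
  rw [Subsingleton.elim i 0, Subsingleton.elim j 0, outer, Matrix.vecMulVec_apply]
  simp [← h, sq]

/-- When `p = 1` positive definiteness does not force `1 - δξ/p > 0`. There every shape is the
identity, which is represented by `a = 1`, `b = 0`. -/
lemma exists_spike_parameters {p : ℕ} (hp : p ≠ 0) {θ₀ : Vec p} (hθ₀ : ‖θ₀‖ = 1) {ξ : ℝ}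
    (hξ : 0 < ξ) {δ : ℕ → ℝ} (hδ : ∀ n, 1 ≤ n → 0 < δ n)
    (hV : ∀ n, 1 ≤ n → (spikeShape ξ (δ n) θ₀).PosDef) :
    ∃ a b : ℕ → ℝ, (∀ n, 1 ≤ n → 0 < a n) ∧ (∀ n, 1 ≤ n → 0 ≤ b n) ∧
      (∀ n (θ : Vec p), ‖θ‖ = 1 → spikeShape ξ (δ n) θ = spike (a n) (b n) θ) ∧
      ((p = 1 ∧ (∀ n, a n = 1) ∧ ∀ n, b n = 0) ∨
        (2 ≤ p ∧ (∀ n, a n = 1 - δ n * ξ / p) ∧ ∀ n, b n = δ n * ξ)) := by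
  rcases (by omega : p = 1 ∨ 2 ≤ p) with rfl | hp2
  · refine ⟨fun _ => 1, fun _ => 0, fun _ _ => one_pos, fun _ _ => le_rfl, fun n θ hθ => ?_,
      Or.inl ⟨rfl, fun _ => rfl, fun _ => rfl⟩⟩
    rw [spikeShape, spike, outer_self_of_dim_one hθ, ← add_smul]
    simp
  · refine ⟨fun n => 1 - δ n * ξ / p, fun n => δ n * ξ, fun n hn => ?_,
      fun n hn => (mul_pos (hδ n hn) hξ).le, fun n θ _ => rfl,
      Or.inr ⟨hp2, fun _ => rfl, fun _ => rfl⟩⟩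
    exact pos_of_posDef_spike hp2 hθ₀ (hV n hn)

lemma gam_eq {p : ℕ} (hp : p ≠ 0) (ξ δ : ℝ) :
    gam p ξ δ = (δ * ξ) / ((1 - δ * ξ / p) + δ * ξ) := by
  have hp' : (p : ℝ) ≠ 0 := by exact_mod_cast hp
  have : (1 - δ * ξ / p) + δ * ξ = (p + (p - 1) * δ * ξ) / p := by field_simp; ring
  rw [this, gam, div_div_eq_mul_div]
  congr 1; ring

/-! ### Limits along bounded sequences -/

/-- The sequence `v` need not converge: continuity at all points of `{x} × K` and compactness make
the limit in the first variable uniform over `K`. -/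
lemma tendsto_zero_of_isCompact {X T : Type*} [TopologicalSpace X] [TopologicalSpace T] {K : Set T}
    (hK : IsCompact K) {f : X × T → ℝ} {x : X} (hf : ∀ t ∈ K, ContinuousAt f (x, t))
    (h0 : ∀ t ∈ K, f (x, t) = 0) {u : ℕ → X} (hu : Tendsto u atTop (𝓝 x)) {v : ℕ → T}
    (hv : ∀ᶠ n in atTop, v n ∈ K) : Tendsto (fun n => f (u n, v n)) atTop (𝓝 0) := by
  rw [Metric.tendsto_nhds]
  intro ε hε
  have h1 : ∀ t ∈ K, ∀ᶠ z in 𝓝 (x, t), dist (f z) 0 < ε := by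
    intro t ht
    have := Metric.tendsto_nhds.1 (hf t ht) ε hε
    rwa [h0 t ht] at this
  have h2 := hK.eventually_forall_of_forall_eventually (x₀ := x)
    (P := fun x t => dist (f (x, t)) 0 < ε) h1
  filter_upwards [hu.eventually h2, hv] with n hn hn'
  exact hn _ hn'

lemma tendsto_zero_of_bounded {p : ℕ} {X : Type*} [TopologicalSpace X] {f : X × Vec p → ℝ} {x : X}
    (hf : ∀ t, ContinuousAt f (x, t)) (h0 : ∀ t, f (x, t) = 0) {u : ℕ → X}
    (hu : Tendsto u atTop (𝓝 x)) {v : ℕ → Vec p} {C : ℝ} (hv : ∀ n, 1 ≤ n → ‖v n‖ ≤ C) :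
    Tendsto (fun n => f (u n, v n)) atTop (𝓝 0) :=
  tendsto_zero_of_isCompact (isCompact_closedBall (0 : Vec p) C) (fun t _ => hf t)
    (fun t _ => h0 t) hu ((eventually_ge_atTop 1).mono fun n hn => by simpa using hv n hn)

lemma isLittleOP_add_const {Ω : ℕ → Type*} [∀ n, MeasurableSpace (Ω n)] {P : ∀ n, Measure (Ω n)}
    {X : ∀ n, Ω n → ℝ} (hX : IsLittleOP P X) {d : ℕ → ℝ} (hd : Tendsto d atTop (𝓝 0)) :
    IsLittleOP P fun n ω => X n ω + d n := by
  intro ε hε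
  refine tendsto_of_tendsto_of_tendsto_of_le_of_le' tendsto_const_nhds (hX (ε / 2) (by positivity))
    (Eventually.of_forall fun n => zero_le) ?_
  filter_upwards [Metric.tendsto_nhds.1 hd (ε / 2) (by positivity)] with n hn
  refine measure_mono fun ω hω => ?_
  simp only [Set.mem_ofPred_eq] at hω ⊢
  rw [Real.dist_eq, sub_zero] at hn
  have := abs_add_le (X n ω) (d n)
  linarith

/-- `-2` times the leading term of `√n` times the whitened difference of the shape matrices,
as a function of the spike parameters, `c = √n γ ν`, `ν` and the local direction `t`. -/
def spikeLeading {p : ℕ} (θ : Vec p) (a b c ν : ℝ) (t : Vec p) (i j : Fin p) : ℝ :=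
  c / a * (√(a + b) * (θ i * (√a * t j + (√(a + b) - √a) * (-(ν * ‖t‖ ^ 2 / 2)) * θ j) +
      (√a * t i + (√(a + b) - √a) * (-(ν * ‖t‖ ^ 2 / 2)) * θ i) * θ j) +
    ν * ((√a * t i + (√(a + b) - √a) * (-(ν * ‖t‖ ^ 2 / 2)) * θ i) *
      (√a * t j + (√(a + b) - √a) * (-(ν * ‖t‖ ^ 2 / 2)) * θ j)))

lemma inner_of_norm_add_smul_eq_one {p : ℕ} {θ t : Vec p} {ν : ℝ} (hν : 0 < ν) (hθ : ‖θ‖ = 1)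
    (h : ‖θ + ν • t‖ = 1) : (inner ℝ θ t : ℝ) = -(ν * ‖t‖ ^ 2 / 2) := by
  have h1 := norm_add_sq_real θ (ν • t)
  rw [h, hθ, real_inner_smul_right, norm_smul, Real.norm_of_nonneg hν.le] at h1
  have h2 : ν * (2 * inner ℝ θ t + ν * ‖t‖ ^ 2) = 0 := by linear_combination -h1
  have := (mul_eq_zero.1 h2).resolve_left hν.ne'
  linarith

/-- The image of `θ + ν t` is the image of `θ` plus `ν` times a vector, so the zeroth-order terms
cancel and a factor `ν` comes out, joining `s b/(a+b)`. The identity is exact; the unit norm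
expresses the component of `t` along `θ` through `‖t‖²`. -/
lemma sqrt_mul_spikeDiff_apply {p : ℕ} {a b ν : ℝ} (ha : 0 < a) (hb : 0 ≤ b)
    (hν : 0 < ν) {θ t : Vec p} (hθ : ‖θ‖ = 1) (h : ‖θ + ν • t‖ = 1) (s : ℝ) (i j : Fin p) :
    s * spikeDiff a b θ (θ + ν • t) i j = -spikeLeading θ a b (s * (b / (a + b)) * ν) ν t i j := by
  have hab : a + b ≠ 0 := by positivity
  have him : spikeImage a b θ (θ + ν • t) = √(a + b) • θ +
      ν • (√a • t + ((√(a + b) - √a) * (-(ν * ‖t‖ ^ 2 / 2))) • θ) := by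
    rw [spikeImage, inner_add_right, real_inner_smul_right, inner_of_norm_add_smul_eq_one hν hθ h,
      real_inner_self_eq_norm_sq, hθ]
    module
  rw [spikeDiff, him, spikeImage_self a b hθ, spikeLeading]
  simp only [outer, Matrix.smul_apply, Matrix.sub_apply, Matrix.vecMulVec_apply, PiLp.smul_apply,
    PiLp.add_apply, smul_eq_mul]
  field_simp
  ring

lemma continuousAt_spikeLeading {p : ℕ} (θ : Vec p) {a b c ν : ℝ} (ha : a ≠ 0) (t : Vec p)
    (i j : Fin p) :
    ContinuousAt (fun z : (ℝ × ℝ × ℝ × ℝ) × Vec p =>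
      spikeLeading θ z.1.1 z.1.2.1 z.1.2.2.1 z.1.2.2.2 z.2 i j) ((a, b, c, ν), t) := by
  unfold spikeLeading
  fun_prop (disch := exact ha)

/-! ### Bilinear forms in the whitened scatter matrix -/

lemma bilin_transpose {p : ℕ} (x : Vec p) (A : Mat p) (y : Vec p) : bilin x Aᵀ y = bilin y A x := by
  rw [bilin_eq_inner, bilin_eq_inner, ← inner_act_left, real_inner_comm]

lemma trace_outer_mul {p : ℕ} (x y : Vec p) (A : Mat p) : (outer x y * A).trace = bilin y A x := by
  rw [Matrix.trace_mul_comm, outer, Matrix.mul_vecMulVec, Matrix.trace_vecMulVec, bilin,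
    dotProduct_comm]

lemma transpose_upsilon {p n : ℕ} (hn : n ≠ 0) {R V : Mat p} (h : IsSqrt R V)
    (U : Fin n → Sph p) : (upsilon V U)ᵀ = upsilon V U := by
  rw [upsilon_eq hn h]
  simp [Matrix.transpose_sum, transpose_outer]

lemma bilin_upsilon_comm {p n : ℕ} (hn : n ≠ 0) {R V : Mat p} (h : IsSqrt R V)
    (U : Fin n → Sph p) (x y : Vec p) : bilin x (upsilon V U) y = bilin y (upsilon V U) x := by
  rw [← bilin_transpose, transpose_upsilon hn h]

lemma abs_apply_le_norm {p : ℕ} (x : Vec p) (i : Fin p) : |x i| ≤ ‖x‖ :=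
  PiLp.norm_apply_le x i

lemma abs_outer_apply_le {p : ℕ} (x y : Vec p) (i j : Fin p) : |outer x y i j| ≤ ‖x‖ * ‖y‖ := by
  rw [outer, Matrix.vecMulVec_apply, abs_mul]
  exact mul_le_mul (abs_apply_le_norm x i) (abs_apply_le_norm y j) (abs_nonneg _) (norm_nonneg _)

lemma act_one_sub_outer {p : ℕ} (θ x : Vec p) :
    act (1 - outer θ θ) x = x - (inner ℝ θ x : ℝ) • θ := by
  have : (1 : Mat p) - outer θ θ = spike 1 (-1) θ := by simp [spike, sub_eq_add_neg]
  rw [this, act_spike]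
  module

lemma inner_act_one_sub_outer {p : ℕ} (θ x y : Vec p) :
    inner ℝ x (act (1 - outer θ θ) y) = inner ℝ (x - (inner ℝ θ x : ℝ) • θ) y := by
  rw [← act_one_sub_outer, inner_act_left, Matrix.transpose_sub, Matrix.transpose_one,
    transpose_outer]

lemma inner_sub_inner_smul_self {p : ℕ} {θ : Vec p} (hθ : ‖θ‖ = 1) (x : Vec p) :
    inner ℝ (x - (inner ℝ θ x : ℝ) • θ) θ = (0 : ℝ) := by
  rw [inner_sub_left, real_inner_smul_left, real_inner_self_eq_norm_sq, hθ, real_inner_comm]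
  ring

lemma bilin_one_sub_outer {p : ℕ} {θ : Vec p} (hθ : ‖θ‖ = 1) (x : Vec p) (c : ℝ) :
    bilin x (c • (1 - outer θ θ)) x = c * ‖x - (inner ℝ θ x : ℝ) • θ‖ ^ 2 := by
  rw [bilin_eq_inner, act_smul_left, real_inner_smul_right, act_one_sub_outer,
    ← real_inner_self_eq_norm_sq]
  congr 1
  conv_rhs => rw [inner_sub_left, real_inner_smul_left, real_inner_comm,
    real_inner_comm (x - _) θ, inner_sub_inner_smul_self hθ, mul_zero, sub_zero, real_inner_comm]

/-! ### Regimes with vanishing local radius -/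

/-- Local asymptotic normality when `ν → 0`: the central sequence is the tangential part of
`Υ θ₀`, scaled by `κ`. -/
theorem isLittleOP_logLik_tangential {p : ℕ} (hp : p ≠ 0) {a b ν : ℕ → ℝ} {τ : ℕ → Vec p}
    {θ₀ : Vec p} {V₀ V₁ : ℕ → Mat p} {κ c C : ℝ} (hθ₀ : ‖θ₀‖ = 1)
    (ha : ∀ n, 1 ≤ n → 0 < a n) (hb : ∀ n, 1 ≤ n → 0 ≤ b n) (hν : ∀ n, 1 ≤ n → 0 < ν n)
    (hτ : ∀ n, 1 ≤ n → ‖τ n‖ ≤ C) (hsph : ∀ n, 1 ≤ n → ‖θ₀ + ν n • τ n‖ = 1)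
    (hV₀ : ∀ n, 1 ≤ n → V₀ n = spike (a n) (b n) θ₀)
    (hV₁ : ∀ n, 1 ≤ n → V₁ n = spike (a n) (b n) (θ₀ + ν n • τ n))
    (hpar : (p = 1 ∧ ∀ n, b n = 0) ∨ ∃ A B, 0 < A ∧ Tendsto a atTop (𝓝 A) ∧
      Tendsto b atTop (𝓝 B) ∧ Tendsto ν atTop (𝓝 0) ∧
      (∀ n : ℕ, 1 ≤ n → √n * (b n / (a n + b n)) * ν n = 1) ∧ κ = √(A + B) / √A)
    (hc : p = 1 ∨ c = p / (p + 2) * κ ^ 2) :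
    IsLittleOP (fun n => sampleLaw n (V₀ n)) fun n U =>
      logLik n (V₀ n) (V₁ n) U -
        (inner ℝ (τ n) ((p * κ : ℝ) • act ((1 - outer θ₀ θ₀) * centeredScatter (V₀ n) U) θ₀) -
          1 / 2 * bilin (τ n) (c • (1 - outer θ₀ θ₀)) (τ n)) := by
  set t : ℕ → Vec p := fun n => τ n - (inner ℝ θ₀ (τ n) : ℝ) • θ₀ with ht
  have htθ : ∀ n, (inner ℝ (t n) θ₀ : ℝ) = 0 := fun n => inner_sub_inner_smul_self hθ₀ _
  have hθt : ∀ n, (inner ℝ θ₀ (t n) : ℝ) = 0 := fun n => by rw [real_inner_comm, htθ]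
  have ht1 : p = 1 → ∀ n, t n = 0 := by
    rintro rfl n
    exact sub_eq_zero.2 (eq_inner_smul_of_dim_one hθ₀ _)
  -- The limit of `-√n E / 2`; the factor `κ` is the limit of `√(a+b) √a / a`.
  set H : ℕ → Mat p := fun n => (κ / 2) • (outer θ₀ (t n) + outer (t n) θ₀) with hH
  have hHb : ∀ n, 1 ≤ n → ∀ i j, |H n i j| ≤ |κ / 2| * (2 * C + 2 * C) := by
    intro n hn i j
    have htn : ‖t n‖ ≤ 2 * C := by
      refine (norm_sub_le _ _).trans ?_
      rw [norm_smul, hθ₀, mul_one, Real.norm_eq_abs]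
      have := abs_real_inner_le_norm θ₀ (τ n)
      rw [hθ₀, one_mul] at this
      linarith [hτ n hn]
    have h1 := abs_outer_apply_le θ₀ (t n) i j
    have h2 := abs_outer_apply_le (t n) θ₀ i j
    rw [hθ₀] at h1 h2
    simp only [hH, Matrix.smul_apply, Matrix.add_apply, smul_eq_mul, abs_mul]
    gcongr
    exact (abs_add_le _ _).trans (by linarith)
  have hlim : ∀ i j, Tendsto (fun n : ℕ =>
      √n * spikeDiff (a n) (b n) θ₀ (θ₀ + ν n • τ n) i j + 2 * H n i j) atTop (𝓝 0) := by
    intro i j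
    rcases hpar with ⟨hp1, hb0⟩ | ⟨A, B, hA, haA, hbB, hν0, hcn, hκ⟩
    · simp [hH, ht1 hp1, spikeDiff, hb0, outer]
    -- The normal component of `τ` is written `-ν ‖τ‖² / 2`, so that the expression is a function of
    -- the parameters and `τ` alone. It vanishes identically in `τ` at `(A, B, 1, 0)`.
    · have hlead : Tendsto (fun n => -spikeLeading θ₀ (a n) (b n) 1 (ν n) (τ n) i j +
          κ * (θ₀ i * (τ n j + ν n * ‖τ n‖ ^ 2 / 2 * θ₀ j) +
            (τ n i + ν n * ‖τ n‖ ^ 2 / 2 * θ₀ i) * θ₀ j)) atTop (𝓝 0) := by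
        refine tendsto_zero_of_bounded (X := ℝ × ℝ × ℝ × ℝ) (x := (A, B, 1, 0))
          (u := fun n => (a n, b n, 1, ν n)) (v := τ) (C := C)
          (f := fun z => -spikeLeading θ₀ z.1.1 z.1.2.1 z.1.2.2.1 z.1.2.2.2 z.2 i j +
          κ * (θ₀ i * (z.2 j + z.1.2.2.2 * ‖z.2‖ ^ 2 / 2 * θ₀ j) +
            (z.2 i + z.1.2.2.2 * ‖z.2‖ ^ 2 / 2 * θ₀ i) * θ₀ j)) (fun t => ?_) (fun t => ?_) ?_ hτ
        · exact (continuousAt_spikeLeading θ₀ hA.ne' t i j).neg.add (by fun_prop)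
        · have h1 := Real.mul_self_sqrt hA.le
          have h2 : √A ≠ 0 := (Real.sqrt_pos.2 hA).ne'
          simp only [spikeLeading, hκ]
          generalize √A = r at h1 h2
          rw [← h1]
          field_simp
          ring
        · exact haA.prodMk_nhds (hbB.prodMk_nhds (tendsto_const_nhds.prodMk_nhds hν0))
      refine hlead.congr' ?_
      filter_upwards [eventually_ge_atTop 1] with n hn
      rw [sqrt_mul_spikeDiff_apply (ha n hn) (hb n hn) (hν n hn) hθ₀ (hsph n hn), hcn n hn]
      simp only [hH, ht, outer, Matrix.smul_apply, Matrix.add_apply, Matrix.vecMulVec_apply,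
        PiLp.sub_apply, PiLp.smul_apply, smul_eq_mul,
        inner_of_norm_add_smul_eq_one (hν n hn) hθ₀ (hsph n hn)]
      ring
  refine isLittleOP_congr ?_ (isLittleOP_logLik_spike_sub hp ha hb hθ₀ hsph hV₀ hV₁ hlim hHb)
  filter_upwards [eventually_ge_atTop 1] with n hn
  refine ae_of_all _ fun U => ?_
  have hS := isSqrt_spike (ha n hn) (hb n hn) hθ₀
  rw [← hV₀ n hn] at hS
  have hn0 : n ≠ 0 := by omega
  have e1 : (H n * upsilon (V₀ n) U).trace = κ * bilin (t n) (upsilon (V₀ n) U) θ₀ := by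
    simp only [hH, Matrix.smul_mul, Matrix.trace_smul, add_mul, Matrix.trace_add, trace_outer_mul,
      bilin_upsilon_comm hn0 hS U θ₀ (t n), smul_eq_mul]
    ring
  have e2 : inner ℝ (τ n) ((p * κ : ℝ) •
      act ((1 - outer θ₀ θ₀) * centeredScatter (V₀ n) U) θ₀) =
      κ * bilin (t n) (upsilon (V₀ n) U) θ₀ := by
    rw [real_inner_smul_right, ← act_act, inner_act_one_sub_outer, upsilon, bilin_eq_inner,
      act_smul_left, real_inner_smul_right]
    ring
  have e3 : p / (p + 2) * (H n * H n).trace =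
      1 / 2 * bilin (τ n) (c • (1 - outer θ₀ θ₀)) (τ n) := by
    rw [bilin_one_sub_outer hθ₀]
    change _ = 1 / 2 * (c * ‖t n‖ ^ 2)
    rcases hc with hp1 | hc
    · simp [hH, ht1 hp1, outer]
    · simp only [hH, Matrix.smul_mul, Matrix.mul_smul, add_mul, mul_add, outer_mul_outer,
        Matrix.trace_smul, Matrix.trace_add, trace_outer, htθ, hθt, real_inner_self_eq_norm_sq,
        hθ₀, smul_eq_mul, hc]
      ring
  simp only [e1, e2, e3]

/-- Asymptotic normality of the scaled tangential part of `Υ θ₀`. -/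
theorem asympNormal_tangential {p : ℕ} (hp : p ≠ 0) {R V : ℕ → Mat p} {θ₀ : Vec p} {κ c : ℝ}
    (hθ₀ : ‖θ₀‖ = 1) (hR : ∀ n, 1 ≤ n → IsSqrt (R n) (V n))
    (hc : p = 1 ∨ c = p / (p + 2) * κ ^ 2) :
    AsympNormal (fun n => sampleLaw n (V n))
      (fun n U => (p * κ : ℝ) • act ((1 - outer θ₀ θ₀) * centeredScatter (V n) U) θ₀)
      (c • ((1 : Mat p) - outer θ₀ θ₀)) := by
  have hp' : (p : ℝ) ≠ 0 := by exact_mod_cast hp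
  set h : Sph p → Vec p := fun w => κ • act (1 - outer θ₀ θ₀)
    ((p : ℝ) • ((inner ℝ (w : Vec p) θ₀ : ℝ) • (w : Vec p) - (1 / (p : ℝ)) • θ₀)) with hh
  have hθt : ∀ t : Vec p, (inner ℝ θ₀ (t - (inner ℝ θ₀ t : ℝ) • θ₀) : ℝ) = 0 := fun t => by
    rw [real_inner_comm, inner_sub_inner_smul_self hθ₀]
  have hcont : Continuous h := by
    have h0 : Continuous fun w : Sph p =>
        (p : ℝ) • ((inner ℝ (w : Vec p) θ₀ : ℝ) • (w : Vec p) - (1 / (p : ℝ)) • θ₀) := by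
      fun_prop
    exact ((continuous_act (1 - outer θ₀ θ₀)).comp h0).const_smul κ
  -- The centering `θ₀ / p` disappears because the projection annihilates `θ₀`.
  have hinner : ∀ w t, (inner ℝ (h w) t : ℝ) = κ * p * (inner ℝ (w : Vec p) θ₀ *
      inner ℝ (w : Vec p) (t - (inner ℝ θ₀ t : ℝ) • θ₀)) := by
    intro w t
    rw [real_inner_comm, hh, real_inner_smul_right, inner_act_one_sub_outer, real_inner_smul_right,
      inner_sub_right, real_inner_smul_right, real_inner_smul_right, inner_sub_inner_smul_self hθ₀,
      real_inner_comm (w : Vec p)]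
    ring
  refine asympNormal_of_whitened_sum hp hR hcont ?_ (fun t => ?_) (fun t => ?_) (fun n hn U => ?_)
  · rw [Matrix.IsHermitian, Matrix.conjTranspose_eq_transpose_of_trivial]
    simp [transpose_outer]
  · simp_rw [hinner]
    rw [integral_const_mul, integral_inner_mul_inner_sphUnif hp, hθt]
    simp
  · simp_rw [hinner, mul_pow]
    change _ = bilin t (c • (1 - outer θ₀ θ₀)) t
    rw [integral_const_mul, integral_inner_sq_mul_inner_sq_sphUnif hp, bilin_one_sub_outer hθ₀,
      hθt, hθ₀]
    rcases hc with rfl | hc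
    · rw [sub_eq_zero.2 (eq_inner_smul_of_dim_one hθ₀ t)]
      simp
    · rw [hc]
      field_simp
      ring
  · have hU : (p * κ : ℝ) • act ((1 - outer θ₀ θ₀) * centeredScatter (V n) U) θ₀ =
        κ • act (1 - outer θ₀ θ₀) (act (upsilon (V n) U) θ₀) := by
      rw [upsilon, act_smul_left, act_smul, smul_smul, act_act, mul_comm]
    have hsum : ∀ (ι : Type) (s : Finset ι) (A : ι → Mat p),
        act (∑ i ∈ s, A i) θ₀ = ∑ i ∈ s, act (A i) θ₀ := by
      intro ι s A
      ext k
      simp [act, Matrix.sum_mulVec]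
    rw [hU, upsilon_eq (by omega) (hR n hn), act_smul_left, act_smul, smul_comm, hsum,
      act_eq_toEuclideanLin (1 - outer θ₀ θ₀), map_sum, Finset.smul_sum]
    congr 1
    refine Finset.sum_congr rfl fun i _ => ?_
    rw [hh, act_eq_toEuclideanLin (1 - outer θ₀ θ₀)]
    congr 2
    rw [act_smul_left, sub_eq_add_neg, act_add_left, act_outer, ← neg_smul, act_smul_left, act_one,
      neg_smul, ← sub_eq_add_neg]

/-! ### The regime `δ = 1 / √n` -/

/-- The vectorized scatter of a direction, centered. -/
lemma inner_vecE {p : ℕ} (w : Sph p) (t : EuclideanSpace ℝ (Fin p × Fin p)) :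
    inner ℝ (vecE ((p : ℝ) • (outer (w : Vec p) w - (1 / (p : ℝ)) • (1 : Mat p)))) t =
      (p : ℝ) * (qf (Matrix.of fun i j => t (j, i)) w -
        (Matrix.of fun i j => t (j, i)).trace / p) := by
  rw [EuclideanSpace.inner_eq_star_dotProduct, star_trivial, dotProduct, Fintype.sum_prod_type,
    Finset.sum_comm, qf_eq_sum, Matrix.trace, Finset.sum_div, ← Finset.sum_sub_distrib,
    Finset.mul_sum]
  refine Finset.sum_congr rfl fun i _ => ?_
  have h1 : ∀ j, (vecE ((p : ℝ) • (outer (w : Vec p) w - (1 / (p : ℝ)) • (1 : Mat p)))) (j, i) =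
      p * ((w : Vec p) i * (w : Vec p) j - 1 / p * if i = j then 1 else 0) := by
    intro j
    simp [vecE, Matrix.vec, outer, Matrix.vecMulVec_apply, Matrix.one_apply]
  simp only [h1, Matrix.of_apply, Matrix.diag_apply]
  have h2 : ∀ j, t.ofLp (j, i) *
      (p * ((w : Vec p) i * (w : Vec p) j - 1 / p * if i = j then 1 else 0)) =
      p * (t (j, i) * ((w : Vec p) i * (w : Vec p) j)) -
        if i = j then p * (1 / p * t (j, i)) else 0 := by
    intro j
    split_ifs <;> ring
  simp_rw [h2]
  rw [Finset.sum_sub_distrib, Finset.sum_ite_eq, if_pos (Finset.mem_univ i), ← Finset.mul_sum]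
  ring

lemma commutationMatrix_apply {p : ℕ} (i k j l : Fin p) :
    commutationMatrix p (i, k) (j, l) = if i = l ∧ j = k then 1 else 0 := by
  simp only [commutationMatrix, Matrix.sum_apply, Matrix.kroneckerMap_apply, Matrix.single_apply]
  simp [ite_and, eq_comm]

lemma Jmat_apply {p : ℕ} (i k j l : Fin p) :
    Jmat p (i, k) (j, l) = if i = k ∧ j = l then 1 else 0 := by
  simp only [Jmat, Matrix.sum_apply, Matrix.kroneckerMap_apply, Matrix.single_apply]
  simp [ite_and, eq_comm]

/-- Reading `t` as a matrix `T`, the identity, `K_p` and `J_p` give the quadratic forms `tr (T'T)`,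
`tr (T²)` and `(tr T)²`, the traces that occur in the second moment of `w' T w`. -/
lemma dotProduct_covIII {p : ℕ} (t : EuclideanSpace ℝ (Fin p × Fin p)) :
    t.ofLp ⬝ᵥ covIII p *ᵥ t.ofLp =
      (p / (p + 2)) * (((Matrix.of fun i j => t (j, i))ᵀ * (Matrix.of fun i j => t (j, i))).trace +
        ((Matrix.of fun i j => t (j, i)) * (Matrix.of fun i j => t (j, i))).trace +
        (Matrix.of fun i j => t (j, i)).trace ^ 2) -
        (Matrix.of fun i j => t (j, i)).trace ^ 2 := by
  have h1 : t.ofLp ⬝ᵥ (1 : Matrix (Fin p × Fin p) (Fin p × Fin p) ℝ) *ᵥ t.ofLp =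
      ((Matrix.of fun i j => t (j, i))ᵀ * (Matrix.of fun i j => t (j, i))).trace := by
    simp [dotProduct, Fintype.sum_prod_type, Matrix.trace, Matrix.mul_apply]
  have h2 : t.ofLp ⬝ᵥ commutationMatrix p *ᵥ t.ofLp =
      ((Matrix.of fun i j => t (j, i)) * (Matrix.of fun i j => t (j, i))).trace := by
    simp only [dotProduct, Matrix.mulVec, Fintype.sum_prod_type, commutationMatrix_apply,
      Matrix.trace, Matrix.mul_apply, Matrix.diag_apply, Matrix.of_apply]
    refine Finset.sum_congr rfl fun i _ => Finset.sum_congr rfl fun k _ => ?_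
    simp [ite_and, mul_comm]
  have h3 : t.ofLp ⬝ᵥ Jmat p *ᵥ t.ofLp = (Matrix.of fun i j => t (j, i)).trace ^ 2 := by
    simp only [dotProduct, Matrix.mulVec, Fintype.sum_prod_type, Jmat_apply, Matrix.trace,
      Matrix.diag_apply, Matrix.of_apply]
    rw [sq, Finset.sum_mul]
    refine Finset.sum_congr rfl fun i _ => ?_
    simp [ite_and]
  rw [covIII, Matrix.sub_mulVec, dotProduct_sub, Matrix.smul_mulVec, dotProduct_smul,
    Matrix.add_mulVec, Matrix.add_mulVec, dotProduct_add, dotProduct_add, h1, h2, h3, smul_eq_mul]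

lemma isHermitian_covIII (p : ℕ) : (covIII p).IsHermitian := by
  rw [Matrix.IsHermitian, Matrix.conjTranspose_eq_transpose_of_trivial]
  have h1 : (commutationMatrix p)ᵀ = commutationMatrix p := by
    ext ⟨i, k⟩ ⟨j, l⟩
    simp only [Matrix.transpose_apply, commutationMatrix_apply, eq_comm, and_comm]
  have h2 : (Jmat p)ᵀ = Jmat p := by
    ext ⟨i, k⟩ ⟨j, l⟩
    simp only [Matrix.transpose_apply, Jmat_apply, and_comm]
  simp [covIII, h1, h2]

/-- The covariance is read off from `p²` times the variance of `w' T w` for every test matrix `T`.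
-/
theorem asympNormal_vecE_upsilon {p : ℕ} (hp : p ≠ 0) {R V : ℕ → Mat p}
    (hR : ∀ n, 1 ≤ n → IsSqrt (R n) (V n)) :
    AsympNormal (fun n => sampleLaw n (V n)) (fun n U => vecE (upsilon (V n) U)) (covIII p) := by
  have := isProbabilityMeasure_sphUnif hp
  have hp' : (p : ℝ) ≠ 0 := by exact_mod_cast hp
  refine asympNormal_of_whitened_sum hp hR
    (h := fun w => vecE ((p : ℝ) • (outer (w : Vec p) w - (1 / (p : ℝ)) • (1 : Mat p)))) ?_
    (isHermitian_covIII p) (fun t => ?_) (fun t => ?_) (fun n hn U => ?_)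
  · refine (PiLp.continuous_toLp 2 _).comp (continuous_pi fun z => ?_)
    simp only [Matrix.vec, Matrix.smul_apply, Matrix.sub_apply, outer, Matrix.vecMulVec_apply]
    fun_prop
  · simp_rw [inner_vecE]
    rw [integral_const_mul, integral_sub, integral_qf hp]
    · simp
    all_goals exact integrable_sphUnif hp (by fun_prop)
  · simp_rw [inner_vecE, dotProduct_covIII]
    set T : Mat p := Matrix.of fun i j => t (j, i)
    have h1 : ∀ w, ((p : ℝ) * (qf T w - T.trace / p)) ^ 2 =
        (p : ℝ) ^ 2 * (qf T w ^ 2 - 2 * (T.trace / p) * qf T w) + T.trace ^ 2 := by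
      intro w; field_simp; ring
    simp_rw [h1]
    rw [integral_add, integral_const_mul, integral_sub, integral_const_mul, integral_qf hp,
      integral_qf_sq hp]
    · have : (p : ℝ) + 2 ≠ 0 := by positivity
      simp only [integral_const, probReal_univ, smul_eq_mul, one_mul]
      field_simp
      ring
    all_goals exact integrable_sphUnif hp (by fun_prop)
  · have hlin : ∀ (c : ℝ) (A : Fin n → Mat p),
        vecE (c • ∑ i, A i) = c • ∑ i, vecE (A i) := by
      intro c A
      ext z
      simp [vecE, Matrix.vec, Matrix.sum_apply]
    rw [upsilon_eq (by omega) (hR n hn), hlin]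

/-- Here `ν` keeps a positive limit, so the term of `E` quadratic in `τ` survives and enters `H`
with weight `1/ξ`, while the distortion by `R` disappears because `b → 0`. -/
theorem isLittleOP_logLik_critical {p : ℕ} (hp : p ≠ 0) {a b ν : ℕ → ℝ} {τ : ℕ → Vec p}
    {θ₀ : Vec p} {V₀ V₁ : ℕ → Mat p} {ξ C : ℝ} (hξ : 0 < ξ) (hθ₀ : ‖θ₀‖ = 1)
    (ha : ∀ n, 1 ≤ n → 0 < a n) (hb : ∀ n, 1 ≤ n → 0 ≤ b n) (hν : ∀ n, 1 ≤ n → 0 < ν n)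
    (hτ : ∀ n, 1 ≤ n → ‖τ n‖ ≤ C) (hsph : ∀ n, 1 ≤ n → ‖θ₀ + ν n • τ n‖ = 1)
    (hV₀ : ∀ n, 1 ≤ n → V₀ n = spike (a n) (b n) θ₀)
    (hV₁ : ∀ n, 1 ≤ n → V₁ n = spike (a n) (b n) (θ₀ + ν n • τ n))
    (hνξ : Tendsto ν atTop (𝓝 (1 / ξ)))
    (hpar : (p = 1 ∧ (∀ n, b n = 0) ∧ ∀ n, 1 ≤ n → ν n = 1 / ξ) ∨
      (Tendsto a atTop (𝓝 1) ∧ Tendsto b atTop (𝓝 0) ∧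
        Tendsto (fun n : ℕ => √n * (b n / (a n + b n)) * ν n) atTop (𝓝 1))) :
    IsLittleOP (fun n => sampleLaw n (V₀ n)) fun n U =>
      logLik n (V₀ n) (V₁ n) U -
        (bilin (τ n) (upsilon (V₀ n) U) θ₀ + 1 / (2 * ξ) * bilin (τ n) (upsilon (V₀ n) U) (τ n) -
          p / (2 * (p + 2)) * (‖τ n‖ ^ 2 - 1 / (4 * ξ ^ 2) * ‖τ n‖ ^ 4)) := by
  set H : ℕ → Mat p := fun n =>
    (1 / 2 : ℝ) • (outer θ₀ (τ n) + outer (τ n) θ₀ + (1 / ξ) • outer (τ n) (τ n)) with hH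
  have hHb : ∀ n, 1 ≤ n → ∀ i j, |H n i j| ≤ 1 / 2 * (C + C + 1 / ξ * (C * C)) := by
    intro n hn i j
    have hC := hτ n hn
    have h1 := abs_outer_apply_le θ₀ (τ n) i j
    have h2 := abs_outer_apply_le (τ n) θ₀ i j
    have h3 := (abs_outer_apply_le (τ n) (τ n) i j).trans
      (mul_le_mul hC hC (norm_nonneg _) ((norm_nonneg _).trans hC))
    rw [hθ₀] at h1 h2
    simp only [hH, Matrix.smul_apply, Matrix.add_apply, smul_eq_mul]
    rw [abs_mul, abs_of_pos (by norm_num : (0 : ℝ) < 1 / 2)]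
    gcongr
    refine (abs_add_le _ _).trans (add_le_add ((abs_add_le _ _).trans
      (add_le_add (by linarith) (by linarith))) ?_)
    rw [abs_mul, abs_of_pos (by positivity : 0 < 1 / ξ)]
    gcongr
  have hlim : ∀ i j, Tendsto (fun n : ℕ =>
      √n * spikeDiff (a n) (b n) θ₀ (θ₀ + ν n • τ n) i j + 2 * H n i j) atTop (𝓝 0) := by
    intro i j
    rcases hpar with ⟨hp1, hb0, hν1⟩ | ⟨haA, hbB, hcn⟩
    · refine tendsto_const_nhds.congr' ?_
      filter_upwards [eventually_ge_atTop 1] with n hn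
      subst hp1
      have hm := inner_of_norm_add_smul_eq_one (hν n hn) hθ₀ (hsph n hn)
      have ht := eq_inner_smul_of_dim_one hθ₀ (τ n)
      set m : ℝ := inner ℝ θ₀ (τ n)
      -- When `p = 1` the matrix `E` is zero, so `H` must vanish. It does, because `θ₀ + τ/ξ` is
      -- again a unit vector on the line of `θ₀`.
      have hm2 : 2 * m + 1 / ξ * m ^ 2 = 0 := by
        rw [ht, norm_smul, hθ₀, hν1 n hn, mul_one, Real.norm_eq_abs, sq_abs] at hm
        linarith
      have hti : ∀ i, (τ n) i = m * θ₀ i := fun i => by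
        conv_lhs => rw [ht]
        rfl
      simp only [hH, spikeDiff, hb0, outer, Matrix.smul_apply, Matrix.add_apply,
        Matrix.vecMulVec_apply, smul_eq_mul, hti]
      linear_combination (-(θ₀ i * θ₀ j)) * hm2
    · have hlead : Tendsto (fun n : ℕ => -spikeLeading θ₀ (a n) (b n)
          (√n * (b n / (a n + b n)) * ν n) (ν n) (τ n) i j +
          (θ₀ i * τ n j + τ n i * θ₀ j + 1 / ξ * (τ n i * τ n j))) atTop (𝓝 0) := by
        refine tendsto_zero_of_bounded (X := ℝ × ℝ × ℝ × ℝ) (x := (1, 0, 1, 1 / ξ))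
          (u := fun n : ℕ => (a n, b n, √n * (b n / (a n + b n)) * ν n, ν n)) (v := τ) (C := C)
          (f := fun z => -spikeLeading θ₀ z.1.1 z.1.2.1 z.1.2.2.1 z.1.2.2.2 z.2 i j +
          (θ₀ i * z.2 j + z.2 i * θ₀ j + 1 / ξ * (z.2 i * z.2 j))) (fun t => ?_) (fun t => ?_) ?_ hτ
        · exact (continuousAt_spikeLeading θ₀ one_ne_zero t i j).neg.add (by fun_prop)
        · simp only [spikeLeading, add_zero, Real.sqrt_one]
          ring
        · exact haA.prodMk_nhds (hbB.prodMk_nhds (hcn.prodMk_nhds hνξ))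
      refine hlead.congr' ?_
      filter_upwards [eventually_ge_atTop 1] with n hn
      rw [sqrt_mul_spikeDiff_apply (ha n hn) (hb n hn) (hν n hn) hθ₀ (hsph n hn)]
      simp only [hH, outer, Matrix.smul_apply, Matrix.add_apply, Matrix.vecMulVec_apply,
        smul_eq_mul]
      ring
  -- `tr (H²)` involves `⟨θ₀, τ⟩ = -ν ‖τ‖² / 2` and equals its limiting form only at `ν = 1/ξ`; the
  -- difference is a vanishing deterministic term.
  have hd : Tendsto (fun n => p / (2 * (p + 2)) * (‖τ n‖ ^ 2 - 1 / (4 * ξ ^ 2) * ‖τ n‖ ^ 4) -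
      p / (p + 2) * (H n * H n).trace) atTop (𝓝 0) := by
    have h1 : Tendsto (fun n => (p : ℝ) / (2 * (p + 2)) *
        (‖τ n‖ ^ 2 - 1 / (4 * ξ ^ 2) * ‖τ n‖ ^ 4) -
        p / (p + 2) * ((2 * ‖τ n‖ ^ 2 + 2 * (ν n * ‖τ n‖ ^ 2 / 2) ^ 2 -
          4 / ξ * (ν n * ‖τ n‖ ^ 2 / 2) * ‖τ n‖ ^ 2 + ‖τ n‖ ^ 4 / ξ ^ 2) / 4)) atTop (𝓝 0) := by
      refine tendsto_zero_of_bounded (X := ℝ) (x := 1 / ξ) (u := ν) (v := τ) (C := C)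
        (f := fun z => (p : ℝ) / (2 * (p + 2)) *
        (‖z.2‖ ^ 2 - 1 / (4 * ξ ^ 2) * ‖z.2‖ ^ 4) -
        p / (p + 2) * ((2 * ‖z.2‖ ^ 2 + 2 * (z.1 * ‖z.2‖ ^ 2 / 2) ^ 2 -
          4 / ξ * (z.1 * ‖z.2‖ ^ 2 / 2) * ‖z.2‖ ^ 2 + ‖z.2‖ ^ 4 / ξ ^ 2) / 4))
        (fun t => by fun_prop) (fun t => ?_) hνξ hτ
      field_simp
      ring
    refine h1.congr' ?_
    filter_upwards [eventually_ge_atTop 1] with n hn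
    congr 2
    have hm := inner_of_norm_add_smul_eq_one (hν n hn) hθ₀ (hsph n hn)
    have hm' : (inner ℝ (τ n) θ₀ : ℝ) = -(ν n * ‖τ n‖ ^ 2 / 2) := by rw [real_inner_comm, hm]
    simp only [hH, Matrix.smul_mul, Matrix.mul_smul, add_mul, mul_add, outer_mul_outer,
      Matrix.trace_smul, Matrix.trace_add, trace_outer, hm, hm', real_inner_self_eq_norm_sq,
      hθ₀, smul_eq_mul]
    field_simp
    ring
  refine isLittleOP_congr ?_ (isLittleOP_add_const
    (isLittleOP_logLik_spike_sub hp ha hb hθ₀ hsph hV₀ hV₁ hlim hHb) hd)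
  filter_upwards [eventually_ge_atTop 1] with n hn
  refine ae_of_all _ fun U => ?_
  have hS := isSqrt_spike (ha n hn) (hb n hn) hθ₀
  rw [← hV₀ n hn] at hS
  have hn0 : n ≠ 0 := by omega
  have e1 : (H n * upsilon (V₀ n) U).trace = bilin (τ n) (upsilon (V₀ n) U) θ₀ +
      1 / (2 * ξ) * bilin (τ n) (upsilon (V₀ n) U) (τ n) := by
    simp only [hH, Matrix.smul_mul, Matrix.trace_smul, add_mul, Matrix.trace_add, trace_outer_mul,
      bilin_upsilon_comm hn0 hS U θ₀ (τ n), smul_eq_mul]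
    field_simp
    ring
  simp only [e1]
  ring

/-! ### Non-informative regime -/

/-- `√n E` is `√n b` times a bounded matrix, so the expansion applies with `H = 0`. Uniformity over
the alternative comes from compactness of the unit sphere, hence no rate on `ν` is needed. -/
theorem isLittleOP_logLik_of_tendsto_zero {p : ℕ} (hp : p ≠ 0) {a b : ℕ → ℝ} {θ₁ : ℕ → Vec p}
    {θ₀ : Vec p} {V₀ V₁ : ℕ → Mat p} (hθ₀ : ‖θ₀‖ = 1)
    (ha : ∀ n, 1 ≤ n → 0 < a n) (hb : ∀ n, 1 ≤ n → 0 ≤ b n) (h₁ : ∀ n, 1 ≤ n → ‖θ₁ n‖ = 1)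
    (hV₀ : ∀ n, 1 ≤ n → V₀ n = spike (a n) (b n) θ₀)
    (hV₁ : ∀ n, 1 ≤ n → V₁ n = spike (a n) (b n) (θ₁ n))
    (haA : Tendsto a atTop (𝓝 1)) (hb0 : Tendsto (fun n : ℕ => √n * b n) atTop (𝓝 0))
    (hbB : Tendsto b atTop (𝓝 0)) :
    IsLittleOP (fun n => sampleLaw n (V₀ n)) fun n U => logLik n (V₀ n) (V₁ n) U := by
  have hk : Tendsto (fun n : ℕ => √n * b n * (a n * (a n + b n))⁻¹) atTop (𝓝 0) := by
    have h1 : Tendsto (fun n : ℕ => (a n * (a n + b n))⁻¹) atTop (𝓝 (1 * (1 + 0))⁻¹) :=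
      (haA.mul (haA.add hbB)).inv₀ (by norm_num)
    simpa using hb0.mul h1
  have hlim : ∀ i j, Tendsto (fun n : ℕ =>
      √n * spikeDiff (a n) (b n) θ₀ (θ₁ n) i j + 2 * (0 : Mat p) i j) atTop (𝓝 0) := by
    intro i j
    have := tendsto_zero_of_isCompact (X := ℝ × ℝ × ℝ) (x := (1, 0, 0))
      (u := fun n : ℕ => (a n, b n, √n * b n * (a n * (a n + b n))⁻¹)) (v := θ₁)
      (isCompact_sphere (0 : Vec p) 1)
      (f := fun z => z.1.2.2 * (spikeImage z.1.1 z.1.2.1 θ₀ θ₀ i *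
        spikeImage z.1.1 z.1.2.1 θ₀ θ₀ j - spikeImage z.1.1 z.1.2.1 θ₀ z.2 i *
        spikeImage z.1.1 z.1.2.1 θ₀ z.2 j)) (fun t _ => ?_) (fun t _ => by simp)
      (haA.prodMk_nhds (hbB.prodMk_nhds hk))
      ((eventually_ge_atTop 1).mono fun n hn => by simpa using h₁ n hn)
    · refine this.congr fun n => ?_
      simp only [spikeDiff, outer, Matrix.smul_apply, Matrix.sub_apply, Matrix.vecMulVec_apply,
        smul_eq_mul, Matrix.zero_apply]
      ring
    · simp only [spikeImage, PiLp.add_apply, PiLp.smul_apply, smul_eq_mul]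
      fun_prop
  have := isLittleOP_logLik_spike_sub hp ha hb hθ₀ h₁ hV₀ hV₁ (H := fun _ => 0) hlim (C := 0)
    (fun n _ i j => by simp)
  simpa using this

end SignPCA

end

/-! ### Reduction of the four regimes to limits of the spike parameters. -/

theorem mainTheorem1
    (p : ℕ) (θ₀ : SignPCA.Vec p) (hθ₀ : ‖θ₀‖ = 1)
    (ξ : ℝ) (hξ : 0 < ξ)
    (δ ν : ℕ → ℝ) (τ : ℕ → SignPCA.Vec p)
    (hδ : ∀ n, 1 ≤ n → 0 < δ n)
    (hV : ∀ n, 1 ≤ n → (SignPCA.spikeShape ξ (δ n) θ₀).PosDef)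
    (hν : ∀ n, 1 ≤ n → 0 < ν n)
    (hτ : ∃ C : ℝ, ∀ n, 1 ≤ n → ‖τ n‖ ≤ C)
    (hsph : ∀ n, 1 ≤ n → ‖θ₀ + ν n • τ n‖ = 1)
    (V₀ V₁ : ℕ → SignPCA.Mat p)
    (hV₀ : ∀ n, V₀ n = SignPCA.spikeShape ξ (δ n) θ₀)
    (hV₁ : ∀ n, V₁ n = SignPCA.spikeShape ξ (δ n) (θ₀ + ν n • τ n)) :
    -- regime (i)
    ((∀ n, 1 ≤ n → δ n = 1) →
      ((∀ n, 1 ≤ n → ν n = 1 / (Real.sqrt n * SignPCA.gam p ξ (δ n))) →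
        SignPCA.IsLittleOP (fun n => SignPCA.sampleLaw n (V₀ n)) fun n U =>
          SignPCA.logLik n (V₀ n) (V₁ n) U -
            (inner ℝ (τ n) (SignPCA.deltaI ξ θ₀ (V₀ n) U) -
              1 / 2 * SignPCA.bilin (τ n) (SignPCA.infoI ξ θ₀) (τ n))) ∧
      SignPCA.AsympNormal (fun n => SignPCA.sampleLaw n (V₀ n))
        (fun n U => SignPCA.deltaI ξ θ₀ (V₀ n) U) (SignPCA.infoI ξ θ₀)) ∧
    -- regime (ii)
    (Tendsto δ atTop (𝓝 0) → Tendsto (fun n : ℕ => Real.sqrt n * δ n) atTop atTop →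
      ((∀ n, 1 ≤ n → ν n = 1 / (Real.sqrt n * SignPCA.gam p ξ (δ n))) →
        SignPCA.IsLittleOP (fun n => SignPCA.sampleLaw n (V₀ n)) fun n U =>
          SignPCA.logLik n (V₀ n) (V₁ n) U -
            (inner ℝ (τ n) (SignPCA.deltaII θ₀ (V₀ n) U) -
              1 / 2 * SignPCA.bilin (τ n) (SignPCA.infoII θ₀) (τ n))) ∧
      SignPCA.AsympNormal (fun n => SignPCA.sampleLaw n (V₀ n))
        (fun n U => SignPCA.deltaII θ₀ (V₀ n) U) (SignPCA.infoII θ₀)) ∧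
    -- regime (iii)
    ((∀ n : ℕ, 1 ≤ n → δ n = 1 / Real.sqrt n) →
      (((∀ n, 1 ≤ n → ν n = 1 / (Real.sqrt n * SignPCA.gam p ξ (δ n))) ∨
          (∀ n, 1 ≤ n → ν n = 1 / ξ)) →
        SignPCA.IsLittleOP (fun n => SignPCA.sampleLaw n (V₀ n)) fun n U =>
          SignPCA.logLik n (V₀ n) (V₁ n) U -
            (SignPCA.bilin (τ n) (SignPCA.upsilon (V₀ n) U) θ₀ +
              1 / (2 * ξ) * SignPCA.bilin (τ n) (SignPCA.upsilon (V₀ n) U) (τ n) -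
              p / (2 * (p + 2)) * (‖τ n‖ ^ 2 - 1 / (4 * ξ ^ 2) * ‖τ n‖ ^ 4))) ∧
      SignPCA.AsympNormal (fun n => SignPCA.sampleLaw n (V₀ n))
        (fun n U => SignPCA.vecE (SignPCA.upsilon (V₀ n) U)) (SignPCA.covIII p)) ∧
    -- regime (iv)
    (Tendsto (fun n : ℕ => Real.sqrt n * δ n) atTop (𝓝 0) →
      SignPCA.IsLittleOP (fun n => SignPCA.sampleLaw n (V₀ n)) fun n U =>
        SignPCA.logLik n (V₀ n) (V₁ n) U) := by
  have hp : p ≠ 0 := by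
    rintro rfl
    simp [EuclideanSpace.norm_eq] at hθ₀
  have hp0 : (0 : ℝ) < p := by positivity
  obtain ⟨C, hC⟩ := hτ
  obtain ⟨a, b, ha, hb, hab, hpar⟩ :=
    SignPCA.exists_spike_parameters hp hθ₀ hξ hδ hV
  have hV₀' : ∀ n, 1 ≤ n → V₀ n = SignPCA.spike (a n) (b n) θ₀ := fun n _ => by
    rw [hV₀ n, hab n θ₀ hθ₀]
  have hV₁' : ∀ n, 1 ≤ n → V₁ n = SignPCA.spike (a n) (b n) (θ₀ + ν n • τ n) := fun n hn => by
    rw [hV₁ n, hab n _ (hsph n hn)]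
  have hR : ∀ n, 1 ≤ n →
      SignPCA.IsSqrt (SignPCA.spike (√(a n)) (√(a n + b n) - √(a n)) θ₀) (V₀ n) := fun n hn => by
    rw [hV₀' n hn]
    exact SignPCA.isSqrt_spike (ha n hn) (hb n hn) hθ₀
  have hsqrt : ∀ n : ℕ, 1 ≤ n → 0 < √(n : ℝ) := fun n hn =>
    Real.sqrt_pos.2 (by exact_mod_cast hn)
  have hlim : 2 ≤ p → Tendsto δ atTop (𝓝 0) → (∀ n, a n = 1 - δ n * ξ / p) →
      (∀ n, b n = δ n * ξ) → Tendsto a atTop (𝓝 1) ∧ Tendsto b atTop (𝓝 0) := by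
    intro _ hδ0 haeq hbeq
    rw [funext haeq, funext hbeq]
    exact ⟨by simpa using ((hδ0.mul_const ξ).div_const (p : ℝ)).const_sub 1,
      by simpa using hδ0.mul_const ξ⟩
  have hgam : (∀ n, a n = 1 - δ n * ξ / p) → (∀ n, b n = δ n * ξ) → ∀ n,
      SignPCA.gam p ξ (δ n) = b n / (a n + b n) := fun haeq hbeq n => by
    rw [SignPCA.gam_eq hp, haeq, hbeq]
  have hscale : (∀ n, a n = 1 - δ n * ξ / p) → (∀ n, b n = δ n * ξ) →
      (∀ n, 1 ≤ n → ν n = 1 / (√n * SignPCA.gam p ξ (δ n))) →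
      ∀ n : ℕ, 1 ≤ n → √n * (b n / (a n + b n)) * ν n = 1 := fun haeq hbeq hνn n hn => by
    have hbn : 0 < b n := by rw [hbeq]; exact mul_pos (hδ n hn) hξ
    rw [hνn n hn, hgam haeq hbeq]
    exact mul_one_div_cancel
      (mul_pos (hsqrt n hn) (div_pos hbn (add_pos (ha n hn) hbn))).ne'
  have hν0 : ∀ A B, 0 < A → 0 ≤ B → (∀ n, a n = 1 - δ n * ξ / p) → (∀ n, b n = δ n * ξ) →
      Tendsto a atTop (𝓝 A) → Tendsto b atTop (𝓝 B) →
      Tendsto (fun n : ℕ => √n * δ n) atTop atTop →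
      (∀ n, 1 ≤ n → ν n = 1 / (√n * SignPCA.gam p ξ (δ n))) → Tendsto ν atTop (𝓝 0) := by
    intro A B hA hB haeq hbeq haA hbB hδ1 hνn
    have hq : Tendsto (fun n : ℕ => ξ / (a n + b n)) atTop (𝓝 (ξ / (A + B))) :=
      tendsto_const_nhds.div (haA.add hbB) (by positivity)
    refine (tendsto_inv_atTop_zero.comp
      (hδ1.atTop_mul_pos (div_pos hξ (by positivity : 0 < A + B)) hq)).congr' ?_
    filter_upwards [eventually_ge_atTop 1] with n hn
    simp only [Function.comp_apply]
    rw [hνn n hn, hgam haeq hbeq, hbeq, one_div]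
    congr 1
    ring
  refine ⟨fun hδ1 => ?_, fun hδ0 hδ1 => ?_, fun hδn => ?_, fun hδ0 => ?_⟩
  -- For `p = 1` and `ξ > 1` the square root of `p - ξ` is 0 by convention and the scalar identity
  -- fails; the projector is zero there. For `p ≥ 2`, positivity of `a 1` gives `ξ < p`.
  · have hc : p = 1 ∨ (p * (p + (p - 1) * ξ) / ((p + 2) * (p - ξ)) : ℝ) =
        p / (p + 2) * (√(p + (p - 1) * ξ) / √(p - ξ)) ^ 2 := by
      rcases hpar with ⟨h1, -, -⟩ | ⟨h2, haeq, -⟩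
      · exact Or.inl h1
      · right
        have hA := ha 1 le_rfl
        rw [haeq, hδ1 1 le_rfl, one_mul, sub_pos, div_lt_one hp0] at hA
        have h2' : (2 : ℝ) ≤ p := by exact_mod_cast h2
        have hnum : 0 ≤ (p + (p - 1) * ξ : ℝ) := by
          have : 0 ≤ ((p : ℝ) - 1) * ξ := mul_nonneg (by linarith) hξ.le
          linarith
        rw [div_pow, Real.sq_sqrt hnum, Real.sq_sqrt (by linarith), div_mul_div_comm]
    refine ⟨fun hνn => ?_, SignPCA.asympNormal_tangential hp hθ₀ hR hc⟩
    refine SignPCA.isLittleOP_logLik_tangential hp hθ₀ ha hb hν hC hsph hV₀' hV₁' ?_ hc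
    rcases hpar with ⟨h1, -, hb0⟩ | ⟨h2, haeq, hbeq⟩
    · exact Or.inl ⟨h1, hb0⟩
    · have hA := ha 1 le_rfl
      rw [haeq, hδ1 1 le_rfl, one_mul] at hA
      have haA : Tendsto a atTop (𝓝 (1 - ξ / p)) := tendsto_const_nhds.congr' <| by
        filter_upwards [eventually_ge_atTop 1] with n hn
        rw [haeq, hδ1 n hn, one_mul]
      have hbB : Tendsto b atTop (𝓝 ξ) := tendsto_const_nhds.congr' <| by
        filter_upwards [eventually_ge_atTop 1] with n hn
        rw [hbeq, hδ1 n hn, one_mul]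
      have hroot : Tendsto (fun n : ℕ => √(n : ℝ) * δ n) atTop atTop :=
        (Real.tendsto_sqrt_atTop.comp tendsto_natCast_atTop_atTop).congr' <| by
          filter_upwards [eventually_ge_atTop 1] with n hn
          simp [hδ1 n hn]
      refine Or.inr ⟨1 - ξ / p, ξ, hA, haA, hbB,
        hν0 _ _ hA hξ.le haeq hbeq haA hbB hroot hνn, hscale haeq hbeq hνn, ?_⟩
      have e1 : (1 - ξ / p + ξ : ℝ) = (p + (p - 1) * ξ) / p := by field_simp; ring
      have e2 : (1 - ξ / p : ℝ) = (p - ξ) / p := by field_simp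
      rw [e1, e2, Real.sqrt_div' _ hp0.le, Real.sqrt_div' _ hp0.le,
        div_div_div_cancel_right₀ (Real.sqrt_pos.2 hp0).ne']
  · have hc : p = 1 ∨ (p / (p + 2) : ℝ) = p / (p + 2) * 1 ^ 2 := Or.inr (by ring)
    have hΔ : ∀ n (U : Fin n → SignPCA.Sph p), SignPCA.deltaII θ₀ (V₀ n) U = (p * 1 : ℝ) •
        SignPCA.act ((1 - SignPCA.outer θ₀ θ₀) * SignPCA.centeredScatter (V₀ n) U) θ₀ :=
      fun n U => by rw [mul_one]; rfl
    simp only [hΔ]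
    refine ⟨fun hνn => ?_, SignPCA.asympNormal_tangential hp hθ₀ hR hc⟩
    refine SignPCA.isLittleOP_logLik_tangential hp hθ₀ ha hb hν hC hsph hV₀' hV₁' ?_ hc
    rcases hpar with ⟨h1, -, hb0⟩ | ⟨h2, haeq, hbeq⟩
    · exact Or.inl ⟨h1, hb0⟩
    · obtain ⟨haA, hbB⟩ := hlim h2 hδ0 haeq hbeq
      exact Or.inr ⟨1, 0, one_pos, haA, hbB,
        hν0 _ _ one_pos le_rfl haeq hbeq haA hbB hδ1 hνn, hscale haeq hbeq hνn, by simp⟩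
  · refine ⟨fun hνn => ?_, SignPCA.asympNormal_vecE_upsilon hp hR⟩
    have hδ0 : Tendsto δ atTop (𝓝 0) :=
      (tendsto_inv_atTop_zero.comp
        (Real.tendsto_sqrt_atTop.comp tendsto_natCast_atTop_atTop)).congr' <| by
          filter_upwards [eventually_ge_atTop 1] with n hn
          simp [hδn n hn]
    rcases hpar with ⟨h1, -, hb0⟩ | ⟨h2, haeq, hbeq⟩
    -- In dimension one `γ = δ ξ`, so both choices of `ν` coincide.
    · have hνξ : ∀ n, 1 ≤ n → ν n = 1 / ξ := by
        rcases hνn with hνn | hνn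
        · intro n hn
          have := (hsqrt n hn).ne'
          subst h1
          rw [hνn n hn, hδn n hn, SignPCA.gam]
          field_simp
          simp
        · exact hνn
      refine SignPCA.isLittleOP_logLik_critical hp hξ hθ₀ ha hb hν hC hsph hV₀' hV₁' ?_
        (Or.inl ⟨h1, hb0, hνξ⟩)
      exact tendsto_const_nhds.congr' <| by
        filter_upwards [eventually_ge_atTop 1] with n hn
        rw [hνξ n hn]
    · obtain ⟨haA, hbB⟩ := hlim h2 hδ0 haeq hbeq
      -- `√n γ → ξ`, hence either choice of `ν` tends to `1/ξ` and `c = √n γ ν` tends to 1.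
      have hrate : Tendsto (fun n : ℕ => √n * (b n / (a n + b n))) atTop (𝓝 ξ) := by
        have hq : Tendsto (fun n : ℕ => ξ / (a n + b n)) atTop (𝓝 ξ) := by
          have := (tendsto_const_nhds (x := ξ)).div (haA.add hbB) (by norm_num)
          rwa [add_zero, div_one] at this
        refine hq.congr' ?_
        filter_upwards [eventually_ge_atTop 1] with n hn
        have hs : √(n : ℝ) * δ n = 1 := by
          rw [hδn n hn]; exact mul_one_div_cancel (hsqrt n hn).ne'
        rw [← mul_div_assoc, hbeq, ← mul_assoc, hs, one_mul]
      have hνξ : Tendsto ν atTop (𝓝 (1 / ξ)) := by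
        rcases hνn with hνn | hνn
        · refine ((tendsto_const_nhds (x := (1 : ℝ))).div hrate hξ.ne').congr' ?_
          filter_upwards [eventually_ge_atTop 1] with n hn
          rw [hνn n hn, hgam haeq hbeq, Pi.div_apply]
        · exact tendsto_const_nhds.congr' <| by
            filter_upwards [eventually_ge_atTop 1] with n hn
            rw [hνn n hn]
      refine SignPCA.isLittleOP_logLik_critical hp hξ hθ₀ ha hb hν hC hsph hV₀' hV₁' hνξ
        (Or.inr ⟨haA, hbB, ?_⟩)
      simpa [hξ.ne'] using hrate.mul hνξ
  · have hlims : Tendsto a atTop (𝓝 1) ∧ Tendsto (fun n : ℕ => √n * b n) atTop (𝓝 0) ∧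
        Tendsto b atTop (𝓝 0) := by
      rcases hpar with ⟨-, ha1, hb0⟩ | ⟨h2, haeq, hbeq⟩
      · simp [funext ha1, funext hb0]
      · have hδ00 : Tendsto δ atTop (𝓝 0) := by
          refine squeeze_zero' ?_ ?_ hδ0
          · filter_upwards [eventually_ge_atTop 1] with n hn using (hδ n hn).le
          · filter_upwards [eventually_ge_atTop 1] with n hn
            exact le_mul_of_one_le_left (hδ n hn).le
              (Real.one_le_sqrt.2 (by exact_mod_cast hn))
        obtain ⟨haA, hbB⟩ := hlim h2 hδ00 haeq hbeq
        refine ⟨haA, ?_, hbB⟩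
        simpa [hbeq, mul_assoc] using hδ0.mul_const ξ
    exact SignPCA.isLittleOP_logLik_of_tendsto_zero hp hθ₀ ha hb hsph hV₀' hV₁'
      hlims.1 hlims.2.1 hlims.2.2
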